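/- Let $\mathbb{K}$ be an infinite field and let $n,r$ be positive integers. Let $B^+\subset GL_n(\mathbb{K})$ be the subgroup of upper triangular matrices, acting on $(\mathbb{K}^n)^{\otimes r}$ by $g(v_1\otimes\dots\otimes v_r)=gv_1\otimes\dots\otimes gv_r$, and let the Borel-Schur algebra $S(B^+)=S(B^+,n,r)$ be the image of the group algebra $\mathbb{K}B^+$ in $\mathrm{End}_{\mathbb{K}}((\mathbb{K}^n)^{\otimes r})$. For multi-indices $i,j\in\{1,\dots,n\}^r$ let $\xi_{i,j}$ be the endomorphism $e_b\mapsto\sum_a e_a$, where $e_a=e_{a_1}\otimes\dots\otimes e_{a_r}$ and the sum is over all multi-indices $a$ such that $(a,b)$ is obtained from $(i,j)$ by a simultaneous permutation of places; the distinct $\xi_{i,j}$ with $i_\rho\le j_\rho$ for all $\rho$ form a $\mathbb{K}$-basis of $S(B^+)$. For a composition $\lambda=(\lambda_1,\dots,\lambda_n)$ of $r$ (non-negative integers with sum $r$) let $\mathbb{K}_\lambda$ be the one-dimensional $S(B^+)$-module on which $\xi_{l,l}$, where $l=(1^{\lambda_1},2^{\lambda_2},\dots,n^{\lambda_n})$,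 acts as the identity and all other basis elements $\xi_{i,j}$ act as zero. A partition is a composition with $\lambda_1\ge\dots\ge\lambda_n$. The socle of $S(B^+)$ is its socle as a left module over itself. Throughout, $p$ is a prime. 1. The module $\mathbb{K}_{(r,0,\dots,0)}$ is a direct summand of the socle of $S(B^+)$, whatever the characteristic of $\mathbb{K}$. 2. If $\mathrm{char}\,\mathbb{K}=0$ and $n=2$, then the socle of $S(B^+)$ is isomorphic to a direct sum of finitely many (at least one) copies of $\mathbb{K}_{(r,0)}$. 3. If $\mathrm{char}\,\mathbb{K}=p$ and $n=2$, then $\mathbb{K}_\lambda$ is a direct summand of the socle of $S(B^+)$ if and only if $\lambda=(r,0)$, or $\lambda$ is a partition with $\lambda_2\ge 1$ and $\lambda_1\ge p^{\lfloor\log_p\lambda_2\rfloor+1}-1$. 4. If $n\ge 3$ and $\mathrm{char}\,\mathbb{K}=0$, then every composition factor of the socle of $S(B^+)$ is isomorphic to $\mathbb{K}_\lambda$ for some partition $\lambda$ with $\lambda_n=0$. 5. If $n\ge 3$ and $\mathrm{char}\,\mathbb{K}=p$, then every composition factor of the socle of $S(B^+)$ is isomorphic to $\mathbb{K}_\lambda$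 for some partition $\lambda$ such that either $\lambda_n=0$ or $\lambda_{n-1}\ge p^{\lfloor\log_p\lambda_n\rfloor+1}-1$. 6. If $n=3$, $\mathrm{char}\,\mathbb{K}=p\ge 3$, and $\lambda=(\lambda_1,\lambda_2,\lambda_3)$ is a composition of $r$ with $\lambda_3\ge 1$, $\lambda_1\ge p^{\lfloor\log_p\lambda_3\rfloor+2}-1$ and $\lambda_2=2p^{\lfloor\log_p\lambda_3\rfloor+1}-1$, then $\mathbb{K}_\lambda$ occurs in the socle of $S(B^+)$ with non-zero multiplicity. -/

import Mathlib

open scoped TensorProduct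

universe u v w

noncomputable section


namespace BorelSchur

/-! ### Modules: direct summands, composition factors, the socle -/

section Modules

variable (R : Type u) [Ring R]

/-- `M` is isomorphic to a direct summand of `N`. -/
def IsDirectSummand (M : Type v) [AddCommGroup M] [Module R M]
    (N : Type w) [AddCommGroup N] [Module R N] : Prop :=
  ∃ P Q : Submodule R N, IsCompl P Q ∧ Nonempty (P ≃ₗ[R] M)

/-- `L` is a composition factor of `N`: it is simple, and isomorphic to a subquotient
`N₂ / N₁` of `N`. -/
def IsCompositionFactor (L : Type v) [AddCommGroup L] [Module R L]
    (N : Type w) [AddCommGroup N] [Module R N] : Prop :=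
  IsSimpleModule R L ∧
    ∃ N₁ N₂ : Submodule R N, N₁ ≤ N₂ ∧ Nonempty ((N₂ ⧸ N₁.submoduleOf N₂) ≃ₗ[R] L)

/-- The (left) socle of a module: the sum of all its simple submodules. -/
def socle (M : Type v) [AddCommGroup M] [Module R M] : Submodule R M :=
  sSup {N : Submodule R M | IsSimpleModule R N}

end Modules

/-! ### Compositions -/

/-- The set `Λ(n, r)` of compositions of `r` into `n` non-negative parts. -/
def Composition (n r : ℕ) : Type := {a : Fin n → ℕ // ∑ ν, a ν = r}

instance (n r : ℕ) : CoeFun (Composition n r) (fun _ => Fin n → ℕ) := ⟨Subtype.val⟩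

/-- A composition is a partition if its parts are weakly decreasing. -/
def Composition.IsPartition {n r : ℕ} (a : Composition n r) : Prop :=
  ∀ μ ν : Fin n, μ ≤ ν → a ν ≤ a μ

/-- The composition `(r, 0, …, 0)`. -/
def topWeight (n r : ℕ) [NeZero n] : Composition n r :=
  ⟨Pi.single 0 r, by simp⟩

/-- The multi-index `l(a) = (1, …, 1, 2, …, 2, …, n, …, n)` in which `ν` occurs `a ν` times. -/
def Composition.index {n r : ℕ} (a : Composition n r) : Fin r → Fin n :=
  fun ρ => (finSigmaFinEquiv.symm (Fin.cast a.2.symm ρ)).1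

/-! ### The Borel subgroup and the Borel-Schur algebra -/

section Algebra

variable (K : Type u) [Field K] (n r : ℕ)

/-- The tensor power `(K^n)^{⊗ r}`. -/
abbrev TensorPow : Type u := ⨂[K] _ : Fin r, (Fin n → K)

/-- The Borel subgroup `B⁺` of upper triangular matrices in `GL_n(K)`. -/
def borel : Subgroup (GL (Fin n) K) where
  carrier := {g | (g : Matrix (Fin n) (Fin n) K).BlockTriangular id}
  mul_mem' {g h} hg hh := by
    simpa using Matrix.BlockTriangular.mul hg hh
  one_mem' := by simpa using Matrix.blockTriangular_one
  inv_mem' {g} hg := by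
    have : Invertible (g : Matrix (Fin n) (Fin n) K) := Units.invertible g
    simpa using Matrix.blockTriangular_inv_of_blockTriangular hg

/-- The diagonal action of `GL_n(K)` on `(K^n)^{⊗ r}`, determined by
`g (v₁ ⊗ ⋯ ⊗ v_r) = g v₁ ⊗ ⋯ ⊗ g v_r`. -/
def tensorAction : GL (Fin n) K →* Module.End K (TensorPow K n r) where
  toFun g := PiTensorProduct.map fun _ => Matrix.toLin' (g : Matrix (Fin n) (Fin n) K)
  map_one' := by
    simp only [Units.val_one, Matrix.toLin'_one]
    exact PiTensorProduct.map_one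
  map_mul' g h := by
    simp only [Units.val_mul, Matrix.toLin'_mul]
    exact PiTensorProduct.map_mul _ _

/-- The homomorphism from the group algebra `K B⁺` to `End_K((K^n)^{⊗ r})`. -/
def groupAlgebraMap : MonoidAlgebra K (borel K n) →ₐ[K] Module.End K (TensorPow K n r) :=
  MonoidAlgebra.lift K (Module.End K (TensorPow K n r)) (borel K n)
    ((tensorAction K n r).comp (borel K n).subtype)

/-- The Borel-Schur algebra `S(B⁺, n, r)`: the image of the group algebra `K B⁺` in
`End_K((K^n)^{⊗ r})`. -/
def borelSchur : Subalgebra K (Module.End K (TensorPow K n r)) :=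
  (groupAlgebraMap K n r).range

/-- The ring structure of the Borel-Schur algebra: its semiring structure as a subalgebra, with
negation `-x = (-1) • x`. -/
instance : Ring (borelSchur K n r) := Algebra.semiringToRing K

/-! ### The basis elements `ξ_{i,j}` and the one-dimensional modules `K_a` -/

/-- The basis `e_{i₁} ⊗ ⋯ ⊗ e_{i_r}` of `(K^n)^{⊗ r}`, indexed by multi-indices. -/
def tensorBasis : Module.Basis (Fin r → Fin n) K (TensorPow K n r) :=
  Basis.piTensorProduct fun _ => Pi.basisFun K (Fin n)

/-- The matrix entry, at multi-indices `(i, j)`, of an endomorphism of `(K^n)^{⊗ r}`. -/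
def entry (x : Module.End K (TensorPow K n r)) (i j : Fin r → Fin n) : K :=
  LinearMap.toMatrix (tensorBasis K n r) (tensorBasis K n r) x i j

/-- `(i, j) ∼ (i', j')`: the two pairs of multi-indices lie in one orbit of the symmetric group
acting by permutation of places. -/
def SameOrbit {n r : ℕ} (i j i' j' : Fin r → Fin n) : Prop :=
  ∃ π : Equiv.Perm (Fin r), i ∘ π = i' ∧ j ∘ π = j'

open Classical in
/-- The element `ξ_{i,j}` of the Schur algebra, which sends the basis vector `e_b` to the sum of all
`e_a` with `(a, b) ∼ (i, j)`. -/
def xi (i j : Fin r → Fin n) : Module.End K (TensorPow K n r) :=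
  Matrix.toLin (tensorBasis K n r) (tensorBasis K n r)
    (Matrix.of fun a b => if SameOrbit i j a b then 1 else 0)

theorem entry_tensorAction (g : GL (Fin n) K) (i j : Fin r → Fin n) :
    entry K n r (tensorAction K n r g) i j = ∏ ρ, (g : Matrix (Fin n) (Fin n) K) (i ρ) (j ρ) := by
  simp [entry, tensorAction, tensorBasis, LinearMap.toMatrix_apply]

variable {K n r} in
/-- Elements of the Borel-Schur algebra are upper triangular: the entry at `(i, j)` vanishes
unless `i ≤ j`. -/
theorem entry_eq_zero {x : Module.End K (TensorPow K n r)} (hx : x ∈ borelSchur K n r)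
    {i j : Fin r → Fin n} (hij : ¬ i ≤ j) : entry K n r x i j = 0 := by
  obtain ⟨f, rfl⟩ := hx
  change entry K n r (groupAlgebraMap K n r f) i j = 0
  rw [groupAlgebraMap, MonoidAlgebra.lift_apply]
  simp only [entry, Finsupp.sum, map_sum, map_smul, Matrix.sum_apply, Matrix.smul_apply]
  refine Finset.sum_eq_zero fun g _ => ?_
  have h := entry_tensorAction K n r (g : GL (Fin n) K) i j
  simp only [entry] at h
  simp only [MonoidHom.comp_apply, Subgroup.subtype_apply, h]
  obtain ⟨ρ, hρ⟩ : ∃ ρ, ¬ i ρ ≤ j ρ := by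
    simpa [Pi.le_def] using hij
  rw [Finset.prod_eq_zero (Finset.mem_univ ρ) (g.2 (by simpa using hρ)), smul_zero]

variable {n r} in
/-- The action of `S(B⁺, n, r)` on the one-dimensional module `K_a`: an element acts by its
diagonal entry at the multi-index `l(a)`. -/
def weightCharacter (a : Composition n r) : borelSchur K n r →+* K where
  toFun x := entry K n r x a.index a.index
  map_one' := by simp [entry]
  map_zero' := by simp [entry]
  map_add' x y := by simp [entry]
  map_mul' x y := by
    have h : entry K n r ((x * y : borelSchur K n r) : Module.End K (TensorPow K n r))
        a.index a.index = ∑ k, entry K n r x a.index k * entry K n r y k a.index := by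
      simp [entry, LinearMap.toMatrix_mul, Matrix.mul_apply]
    rw [h]
    refine Finset.sum_eq_single _ (fun k _ hk => ?_) (fun h => absurd (Finset.mem_univ _) h)
    by_cases h₁ : a.index ≤ k
    · have h₂ : ¬ k ≤ a.index := fun h₂ => hk (le_antisymm h₂ h₁)
      rw [entry_eq_zero y.2 h₂, mul_zero]
    · rw [entry_eq_zero x.2 h₁, zero_mul]

variable {n r} in
/-- The one-dimensional `S(B⁺, n, r)`-module `K_a`. -/
def WeightModule (_a : Composition n r) : Type u := K

variable {n r} in
instance (a : Composition n r) : AddCommGroup (WeightModule K a) :=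
  inferInstanceAs (AddCommGroup K)

variable {n r} in
instance (a : Composition n r) : Module (borelSchur K n r) (WeightModule K a) :=
  Module.compHom K (weightCharacter K a)

open Classical in
/-- On `K_a` the element `ξ_a = ξ_{l,l}`, with `l = l(a)`, acts as the identity, and all other
`ξ_{i,j}` act as zero. -/
theorem xi_smul (a : Composition n r) (i j : Fin r → Fin n) (s : borelSchur K n r)
    (hs : (s : Module.End K (TensorPow K n r)) = xi K n r i j) (v : WeightModule K a) :
    s • v = if SameOrbit i j a.index a.index then v else 0 := by
  have h : weightCharacter K a s = if SameOrbit i j a.index a.index then 1 else 0 := by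
    simp [weightCharacter, hs, entry, xi]
  change (HMul.hMul (α := K) (β := K) (weightCharacter K a s) v : K) = _
  rw [h]
  split_ifs
  · exact one_mul (M := K) v
  · exact zero_mul (M₀ := K) v

/-- The left socle of the Borel-Schur algebra `S(B⁺, n, r)`. -/
abbrev borelSchurSocle : Submodule (borelSchur K n r) (borelSchur K n r) :=
  socle (borelSchur K n r) (borelSchur K n r)

end Algebra

end BorelSchur

end

open BorelSchur

open Finset

theorem exists_perm_comp_eq {α β : Type*} [Fintype α] [DecidableEq α] [DecidableEq β] (f g : α → β)
    (h : ∀ b, #{a | f a = b} = #{a | g a = b}) : ∃ σ : Equiv.Perm α, f ∘ σ = g := by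
  have e : ∀ b, {a // g a = b} ≃ {a // f a = b} := fun b =>
    Fintype.equivOfCardEq (by simpa [Fintype.card_subtype] using (h b).symm)
  exact ⟨Equiv.ofFiberEquiv e, funext fun a => Equiv.ofFiberEquiv_map e a⟩

namespace BorelSchur

/-! ### Weights, matrix entries, and the description of the Borel-Schur algebra by its entries -/

section Entries

variable {K : Type u} [Field K] {n r : ℕ}

/-- The number of occurrences of each value in a multi-index. -/
noncomputable def weight (i : Fin r → Fin n) : Fin n → ℕ := fun ν => #{ρ | i ρ = ν}

theorem sum_weight (i : Fin r → Fin n) : ∑ ν, weight i ν = r := by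
  have := Finset.card_eq_sum_card_fiberwise (f := i) (s := univ) (t := univ) (by simp)
  simpa [weight] using this.symm

/-- The weight of a multi-index, as a composition. -/
noncomputable def weightComp (i : Fin r → Fin n) : Composition n r := ⟨weight i, sum_weight i⟩

theorem weight_comp_perm (i : Fin r → Fin n) (π : Equiv.Perm (Fin r)) :
    weight (i ∘ π) = weight i := by
  funext ν
  exact Finset.card_bij (fun ρ _ => π ρ) (by simp) (by simp)
    (fun ρ h => ⟨π.symm ρ, by simpa using h, by simp⟩)

theorem exists_perm_of_weight_eq {i j : Fin r → Fin n} (h : weight i = weight j) :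
    ∃ π : Equiv.Perm (Fin r), i ∘ π = j :=
  exists_perm_comp_eq i j fun ν => congrFun h ν

theorem weight_index (a : Composition n r) : weight a.index = a.1 := by
  funext ν
  have h1 : weight a.index ν =
      #{x : Σ ν : Fin n, Fin (a ν) | x.1 = ν} := by
    refine Finset.card_bij (fun ρ _ => finSigmaFinEquiv.symm (Fin.cast a.2.symm ρ)) ?_ ?_ ?_
    · intro ρ hρ
      exact mem_filter.2 ⟨mem_univ _, (mem_filter.1 hρ).2⟩
    · intro x _ y _ hxy
      simpa using hxy
    · intro y hy
      refine ⟨Fin.cast a.2 (finSigmaFinEquiv y), mem_filter.2 ⟨mem_univ _, ?_⟩, by simp⟩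
      simpa [Composition.index] using hy
  rw [h1]
  have : ({x : Σ ν : Fin n, Fin (a ν) | x.1 = ν} : Finset _) =
      (univ : Finset (Fin (a ν))).map (Function.Embedding.sigmaMk (β := fun ν => Fin (a ν)) ν) := by
    ext ⟨μ, y⟩
    simp only [mem_filter, mem_univ, true_and, mem_map, Function.Embedding.sigmaMk_apply]
    constructor
    · rintro rfl
      exact ⟨y, rfl⟩
    · rintro ⟨z, hz⟩
      exact (congrArg Sigma.fst hz).symm
  rw [this, card_map, card_univ, Fintype.card_fin]

/-- Equal weights give equal sums of entries, so no place can increase strictly. This makes the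
triangular order strict between distinct multi-indices of one weight. -/
theorem eq_of_le_of_weight_eq {i j : Fin r → Fin n} (hij : i ≤ j) (h : weight i = weight j) :
    i = j := by
  obtain ⟨π, hπ⟩ := exists_perm_of_weight_eq h
  have hs : ∑ ρ, (i ρ : ℕ) = ∑ ρ, (j ρ : ℕ) := by
    rw [← hπ]
    exact (Equiv.sum_comp π fun ρ => (i ρ : ℕ)).symm
  funext ρ
  exact Fin.ext ((Finset.sum_eq_sum_iff_of_le fun ρ _ => Fin.le_def.1 (hij ρ)).1 hs ρ (mem_univ ρ))

variable (K n r) in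
/-- The endomorphism with given matrix entries. -/
noncomputable def ofEntries : Matrix (Fin r → Fin n) (Fin r → Fin n) K ≃ₗ[K] Module.End K (TensorPow K n r) :=
  Matrix.toLin (tensorBasis K n r) (tensorBasis K n r)

@[simp] theorem entry_ofEntries (M : Matrix (Fin r → Fin n) (Fin r → Fin n) K)
    (i j : Fin r → Fin n) : entry K n r (ofEntries K n r M) i j = M i j := by
  simp [entry, ofEntries]

@[simp] theorem entry_add (x y : Module.End K (TensorPow K n r)) (i j : Fin r → Fin n) :
    entry K n r (x + y) i j = entry K n r x i j + entry K n r y i j := by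
  simp [entry]

@[simp] theorem entry_zero (i j : Fin r → Fin n) :
    entry K n r 0 i j = 0 := by
  simp [entry]

@[simp] theorem entry_smul (c : K) (x : Module.End K (TensorPow K n r)) (i j : Fin r → Fin n) :
    entry K n r (c • x) i j = c * entry K n r x i j := by
  simp [entry]

theorem entry_mul (x y : Module.End K (TensorPow K n r)) (i j : Fin r → Fin n) :
    entry K n r (x * y) i j = ∑ k, entry K n r x i k * entry K n r y k j := by
  simp [entry, LinearMap.toMatrix_mul, Matrix.mul_apply]

theorem entry_ext {x y : Module.End K (TensorPow K n r)}
    (h : ∀ i j, entry K n r x i j = entry K n r y i j) : x = y :=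
  (LinearMap.toMatrix (tensorBasis K n r) (tensorBasis K n r)).injective (Matrix.ext h)

theorem ofEntries_entry (x : Module.End K (TensorPow K n r)) :
    ofEntries K n r (Matrix.of fun i j => entry K n r x i j) = x :=
  entry_ext fun i j => by simp

theorem tensorAction_mem {g : GL (Fin n) K} (hg : g ∈ borel K n) :
    tensorAction K n r g ∈ borelSchur K n r :=
  ⟨MonoidAlgebra.single ⟨g, hg⟩ 1, by simp [groupAlgebraMap]⟩

theorem entry_comp_perm {x : Module.End K (TensorPow K n r)} (hx : x ∈ borelSchur K n r)
    (i j : Fin r → Fin n) (π : Equiv.Perm (Fin r)) :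
    entry K n r x (i ∘ π) (j ∘ π) = entry K n r x i j := by
  obtain ⟨f, rfl⟩ := hx
  change entry K n r (groupAlgebraMap K n r f) _ _ = entry K n r (groupAlgebraMap K n r f) _ _
  induction f using MonoidAlgebra.induction_on with
  | of g =>
    have := entry_tensorAction K n r (g : GL (Fin n) K)
    simp [groupAlgebraMap, this]
    exact Equiv.prod_comp π fun ρ => ((g : GL (Fin n) K) : Matrix (Fin n) (Fin n) K) (i ρ) (j ρ)
  | add f g hf hg => simp [hf, hg]
  | smul c f hf => simp [hf]

/-- The exponent of the monomial `∏ X_{i_ρ, j_ρ}`. -/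
noncomputable def pairExponent (q : (Fin r → Fin n) × (Fin r → Fin n)) : Fin n × Fin n →₀ ℕ :=
  ∑ ρ, Finsupp.single (q.1 ρ, q.2 ρ) 1

theorem pairExponent_apply (q : (Fin r → Fin n) × (Fin r → Fin n)) (s : Fin n × Fin n) :
    pairExponent q s = #{ρ | (q.1 ρ, q.2 ρ) = s} := by
  simp only [pairExponent, Finsupp.finsetSum_apply, Finsupp.single_apply, Finset.card_filter]

theorem monomial_pairExponent (q : (Fin r → Fin n) × (Fin r → Fin n)) (c : K) :
    MvPolynomial.monomial (pairExponent q) c =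
      MvPolynomial.C c * ∏ ρ, MvPolynomial.X (q.1 ρ, q.2 ρ) := by
  rw [pairExponent, ← mul_one c, ← MvPolynomial.C_mul_monomial, MvPolynomial.monomial_sum_one]
  simp [MvPolynomial.X]

/-- Over an infinite field the Borel-Schur algebra consists of all endomorphisms whose matrix is
upper triangular and invariant under simultaneous permutations of places. -/
theorem mem_borelSchur_of_entries [Infinite K] {x : Module.End K (TensorPow K n r)}
    (hperm : ∀ (i j : Fin r → Fin n) (π : Equiv.Perm (Fin r)),
      entry K n r x (i ∘ π) (j ∘ π) = entry K n r x i j)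
    (htri : ∀ i j, ¬ i ≤ j → entry K n r x i j = 0) : x ∈ borelSchur K n r := by
  classical
  by_contra hx
  -- A linear functional vanishing on the algebra but not at `x`. Its values on upper triangular
  -- group elements are a polynomial in their matrix entries, and that polynomial will turn out to
  -- be zero.
  obtain ⟨φ, hφx, hφ⟩ := Submodule.exists_le_ker_of_notMem
    (p := Subalgebra.toSubmodule (borelSchur K n r)) (v := x) (by simpa using hx)
  let c : (Fin r → Fin n) × (Fin r → Fin n) → K := fun q =>
    φ (ofEntries K n r (Matrix.single q.1 q.2 1))
  have hexp : ∀ y, φ y = ∑ q, entry K n r y q.1 q.2 * c q := by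
    intro y
    conv_lhs => rw [← ofEntries_entry y,
      Matrix.matrix_eq_sum_single (Matrix.of fun i j => entry K n r y i j)]
    rw [Fintype.sum_prod_type]
    simp only [map_sum, c, Matrix.of_apply]
    refine Finset.sum_congr rfl fun i _ => Finset.sum_congr rfl fun j _ => ?_
    rw [← smul_eq_mul, ← map_smul, ← map_smul, Matrix.smul_single, smul_eq_mul, mul_one]
  let P : MvPolynomial (Fin n × Fin n) K :=
    ∑ q ∈ univ.filter (fun q : (Fin r → Fin n) × (Fin r → Fin n) => q.1 ≤ q.2),
      MvPolynomial.monomial (pairExponent q) (c q)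
  -- The factor `∏ X_{ν,ν}` is the determinant of the upper triangular matrix, so points that do not
  -- give an element of the group are harmless.
  have hP : P * ∏ ν, MvPolynomial.X (ν, ν) = 0 := by
    apply MvPolynomial.funext
    intro w
    rw [map_mul, map_zero, map_prod]
    simp only [MvPolynomial.eval_X]
    by_cases hw : ∏ ν, w (ν, ν) = 0
    · rw [hw, mul_zero]
    let M : Matrix (Fin n) (Fin n) K := Matrix.of fun μ ν => if μ ≤ ν then w (μ, ν) else 0
    have hM : M.BlockTriangular id := by
      intro μ ν h
      simp only [id] at h
      simp [M, not_le.2 h]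
    have hdet : M.det ≠ 0 := by
      rw [Matrix.det_of_isUpperTriangular hM]
      simpa [M] using hw
    have hg : Matrix.GeneralLinearGroup.mkOfDetNeZero M hdet ∈ borel K n := hM
    have h0 := LinearMap.mem_ker.1 (hφ (tensorAction_mem (r := r) hg))
    rw [hexp] at h0
    rw [show MvPolynomial.eval w P = 0 from ?_, zero_mul]
    rw [← h0]
    simp only [P, map_sum, entry_tensorAction]
    rw [Finset.sum_filter]
    refine Finset.sum_congr rfl fun q _ => ?_
    split_ifs with hq
    · rw [monomial_pairExponent]
      simp only [map_mul, MvPolynomial.eval_C, map_prod, MvPolynomial.eval_X]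
      rw [mul_comm]
      congr 1
      refine Finset.prod_congr rfl fun ρ _ => ?_
      change _ = M _ _
      simp [M, hq ρ]
    · obtain ⟨ρ, hρ⟩ : ∃ ρ, ¬ q.1 ρ ≤ q.2 ρ := by simpa [Pi.le_def] using hq
      rw [Finset.prod_eq_zero (mem_univ ρ), zero_mul]
      change M _ _ = 0
      simp [M, hρ]
  have hP0 : P = 0 := by
    refine (mul_eq_zero.1 hP).resolve_right ?_
    exact Finset.prod_ne_zero_iff.2 fun ν _ => MvPolynomial.X_ne_zero _
  -- Two pairs of multi-indices give the same monomial exactly when they lie in one orbit, and on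
  -- orbits the entries of `x` are constant.
  have hfac : Function.FactorsThrough
      (fun q : (Fin r → Fin n) × (Fin r → Fin n) => entry K n r x q.1 q.2) pairExponent := by
    intro q q' hq
    obtain ⟨π, hπ⟩ := exists_perm_comp_eq (fun ρ => (q.1 ρ, q.2 ρ)) (fun ρ => (q'.1 ρ, q'.2 ρ))
      fun s => by
        have := DFunLike.congr_fun hq s
        simpa only [pairExponent_apply] using this
    have h1 : q.1 ∘ π = q'.1 := funext fun ρ => congrArg Prod.fst (congrFun hπ ρ)
    have h2 : q.2 ∘ π = q'.2 := funext fun ρ => congrArg Prod.snd (congrFun hπ ρ)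
    change entry K n r x q.1 q.2 = entry K n r x q'.1 q'.2
    rw [← h1, ← h2, hperm]
  let e := Function.extend pairExponent
    (fun q : (Fin r → Fin n) × (Fin r → Fin n) => entry K n r x q.1 q.2) 0
  -- Replacing each monomial by the corresponding entry of `x` sends `P` to `φ x`; as `P = 0`, this
  -- contradicts the choice of `φ`.
  let Lin : MvPolynomial (Fin n × Fin n) K →ₗ[K] K := (MvPolynomial.basisMonomials _ K).constr K e
  have hLin : ∀ d (a : K), Lin (MvPolynomial.monomial d a) = a * e d := by
    intro d a
    have : MvPolynomial.monomial d a = a • MvPolynomial.basisMonomials (Fin n × Fin n) K d := by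
      simp [MvPolynomial.smul_monomial]
    rw [this, map_smul, Module.Basis.constr_basis, smul_eq_mul]
  apply hφx
  rw [hexp]
  have : Lin P = 0 := by rw [hP0, map_zero]
  rw [← this]
  simp only [P, map_sum, hLin]
  rw [Finset.sum_filter]
  refine Finset.sum_congr rfl fun q _ => ?_
  split_ifs with hq
  · rw [mul_comm]
    congr 1
    exact (hfac.extend_apply _ q).symm
  · rw [htri _ _ hq, zero_mul]

end Entries

end BorelSchur

namespace BorelSchur

/-! ### Simple submodules and the socle -/

section Socle

variable {R : Type u} [Ring R] {M : Type v} [AddCommGroup M] [Module R M]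

instance isSemisimpleModule_socle : IsSemisimpleModule R (socle R M) := by
  rw [socle, sSup_eq_iSup]
  refine isSemisimpleModule_biSup_of_isSemisimpleModule_submodule fun N hN => ?_
  have : IsSimpleModule R N := hN
  infer_instance

theorem le_socle {N : Submodule R M} (hN : IsSimpleModule R N) : N ≤ socle R M :=
  le_sSup hN

variable {L : Type w} [AddCommGroup L] [Module R L]

theorem exists_submodule_socle_linearEquiv [IsSimpleModule R L] (f : L →ₗ[R] M)
    (hf : Function.Injective f) : ∃ P : Submodule R (socle R M), Nonempty (P ≃ₗ[R] L) := by
  let e := LinearEquiv.ofInjective f hf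
  have hs : IsSimpleModule R (LinearMap.range f) := IsSimpleModule.congr e.symm
  exact ⟨_, ⟨(Submodule.submoduleOfEquivOfLe (le_socle hs)).trans e.symm⟩⟩

theorem isDirectSummand_socle_of_injective [IsSimpleModule R L] (f : L →ₗ[R] M)
    (hf : Function.Injective f) : IsDirectSummand R L (socle R M) := by
  obtain ⟨P, hP⟩ := exists_submodule_socle_linearEquiv f hf
  obtain ⟨Q, hQ⟩ := exists_isCompl P
  exact ⟨P, Q, hQ, hP⟩

theorem IsDirectSummand.exists_injective (h : IsDirectSummand R L (socle R M)) :
    ∃ f : L →ₗ[R] M, Function.Injective f := by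
  obtain ⟨P, Q, -, ⟨e⟩⟩ := h
  exact ⟨(socle R M).subtype ∘ₗ P.subtype ∘ₗ e.symm.toLinearMap,
    (Submodule.subtype_injective _).comp ((Submodule.subtype_injective _).comp e.symm.injective)⟩

theorem isCompositionFactor_socle_of_injective [IsSimpleModule R L] (f : L →ₗ[R] M)
    (hf : Function.Injective f) : IsCompositionFactor R L (socle R M) := by
  obtain ⟨P, ⟨e⟩⟩ := exists_submodule_socle_linearEquiv f hf
  refine ⟨inferInstance, ⊥, P, bot_le, ⟨(Submodule.quotEquivOfEqBot _ ?_).trans e⟩⟩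
  simp [Submodule.submoduleOf]

/-- The socle is semisimple, so each of its subquotients is isomorphic to a submodule. -/
theorem IsCompositionFactor.exists_injective (h : IsCompositionFactor R L (socle R M)) :
    ∃ f : L →ₗ[R] M, Function.Injective f := by
  obtain ⟨-, N₁, N₂, -, ⟨e⟩⟩ := h
  obtain ⟨P, ⟨e'⟩⟩ :=
    IsSemisimpleModule.exists_submodule_linearEquiv_quotient (N₁.submoduleOf N₂)
  exact ⟨(socle R M).subtype ∘ₗ N₂.subtype ∘ₗ P.subtype ∘ₗ (e.symm.trans e'.symm).toLinearMap,
    (Submodule.subtype_injective _).comp ((Submodule.subtype_injective _).comp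
      ((Submodule.subtype_injective _).comp (e.symm.trans e'.symm).injective))⟩

theorem isIsotypicOfType_socle
    (h : ∀ N : Submodule R M, IsSimpleModule R N → Nonempty (N ≃ₗ[R] L)) :
    IsIsotypicOfType R (socle R M) L := by
  intro m hm
  let e := m.equivMapOfInjective _ (socle R M).subtype_injective
  obtain ⟨e'⟩ := h (m.map (socle R M).subtype) (IsSimpleModule.congr e.symm)
  exact ⟨e.trans e'⟩

end Socle

/-! ### Weight vectors and simple left ideals -/

section WeightVectors

variable {K : Type u} [Field K] {n r : ℕ}

theorem entry_diag {x : Module.End K (TensorPow K n r)} (hx : x ∈ borelSchur K n r)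
    {i j : Fin r → Fin n} (h : weight i = weight j) : entry K n r x i i = entry K n r x j j := by
  obtain ⟨π, rfl⟩ := exists_perm_of_weight_eq h
  rw [entry_comp_perm hx]

theorem weightCharacter_apply (a : Composition n r) (x : borelSchur K n r) :
    weightCharacter K a x = entry K n r x a.index a.index := rfl

theorem weightCharacter_eq (a : Composition n r) (x : borelSchur K n r) {i : Fin r → Fin n}
    (hi : weight i = a.1) : weightCharacter K a x = entry K n r x i i := by
  rw [weightCharacter_apply]
  exact entry_diag x.2 (by rw [weight_index, hi])

theorem weightCharacter_smul_one (a : Composition n r) (c : K) :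
    weightCharacter K a (c • (1 : borelSchur K n r)) = c := by
  rw [weightCharacter_apply]
  simp [entry]

/-- A vector of the regular module on which the Borel-Schur algebra acts through the character of
`K_a`. -/
noncomputable def IsWeightVector (a : Composition n r) (x : borelSchur K n r) : Prop :=
  ∀ y : borelSchur K n r, y * x = weightCharacter K a y • x

theorem isSimpleModule_weightModule (a : Composition n r) :
    IsSimpleModule (borelSchur K n r) (WeightModule K a) := by
  rw [isSimpleModule_iff_toSpanSingleton_surjective]
  refine ⟨inferInstanceAs (Nontrivial K), fun m hm c => ?_⟩
  let m' : K := m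
  let c' : K := c
  refine ⟨(c' / m') • 1, ?_⟩
  change weightCharacter K a ((c' / m') • 1) * m' = c'
  rw [weightCharacter_smul_one]
  exact div_mul_cancel₀ c' hm

/-- The homomorphism from `K_a` determined by a weight vector. -/
noncomputable def IsWeightVector.linearMap {a : Composition n r} {x : borelSchur K n r}
    (hx : IsWeightVector a x) : WeightModule K a →ₗ[borelSchur K n r] borelSchur K n r where
  toFun c := (show K from c) • x
  map_add' c d := add_smul (R := K) c d x
  map_smul' y c := by
    change (weightCharacter K a y * (show K from c)) • x = y * ((show K from c) • x)
    rw [mul_smul_comm, hx y, smul_smul, mul_comm]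

theorem IsWeightVector.linearMap_injective {a : Composition n r} {x : borelSchur K n r}
    (hx : IsWeightVector a x) (h0 : x ≠ 0) : Function.Injective hx.linearMap :=
  smul_left_injective K h0

theorem exists_isWeightVector_of_injective {a : Composition n r}
    (f : WeightModule K a →ₗ[borelSchur K n r] borelSchur K n r) (hf : Function.Injective f) :
    ∃ x : borelSchur K n r, x ≠ 0 ∧ IsWeightVector a x := by
  let u : WeightModule K a := (1 : K)
  refine ⟨f u, fun h => ?_, fun y => ?_⟩
  · exact one_ne_zero (α := K) (hf (h.trans (map_zero f).symm))
  · have h : y • u = (weightCharacter K a y • (1 : borelSchur K n r)) • u := by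
      change weightCharacter K a y * 1 = weightCharacter K a (_ • 1) * 1
      rw [weightCharacter_smul_one]
    have h1 := congrArg f h
    rw [map_smul, map_smul, smul_eq_mul, smul_eq_mul, smul_mul_assoc, one_mul] at h1
    exact h1

/-- Any simple submodule splits off the semisimple socle, so occurring as a summand amounts to
embedding in the regular module, and an embedding of `K_a` is determined by the image of `1`. -/
theorem isDirectSummand_socle_iff {a : Composition n r} :
    IsDirectSummand (borelSchur K n r) (WeightModule K a) (borelSchurSocle K n r) ↔
      ∃ x : borelSchur K n r, x ≠ 0 ∧ IsWeightVector a x := by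
  have := isSimpleModule_weightModule (K := K) a
  constructor
  · intro h
    obtain ⟨f, hf⟩ := h.exists_injective
    exact exists_isWeightVector_of_injective f hf
  · rintro ⟨x, hx0, hx⟩
    exact isDirectSummand_socle_of_injective hx.linearMap (hx.linearMap_injective hx0)

variable [Infinite K]

/-- The element of the Borel-Schur algebra with given matrix entries. -/
noncomputable def ofMatrix (M : Matrix (Fin r → Fin n) (Fin r → Fin n) K)
    (hperm : ∀ (i j : Fin r → Fin n) (π : Equiv.Perm (Fin r)), M (i ∘ π) (j ∘ π) = M i j)
    (htri : ∀ i j, ¬ i ≤ j → M i j = 0) : borelSchur K n r :=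
  ⟨ofEntries K n r M, mem_borelSchur_of_entries (by simpa using hperm) (by simpa using htri)⟩

@[simp] theorem entry_ofMatrix (M : Matrix (Fin r → Fin n) (Fin r → Fin n) K) (hperm htri)
    (i j : Fin r → Fin n) : entry K n r (ofMatrix M hperm htri) i j = M i j := by
  simp [ofMatrix]

open Classical in
variable (K) in
/-- The idempotent projecting onto the weight space of weight `a`. -/
noncomputable def weightIdempotent (a : Composition n r) : borelSchur K n r :=
  ofMatrix (Matrix.of fun i j => if i = j ∧ weight i = a.1 then 1 else 0)
    (fun i j π => by
      have : i ∘ π = j ∘ π ↔ i = j := π.surjective.injective_comp_right.eq_iff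
      simp only [Matrix.of_apply, this, weight_comp_perm])
    (fun i j h => if_neg fun h' => h h'.1.le)

open Classical in
theorem entry_weightIdempotent (a : Composition n r) (i j : Fin r → Fin n) :
    entry K n r (weightIdempotent K a) i j = if i = j ∧ weight i = a.1 then 1 else 0 := by
  exact entry_ofMatrix _ _ _ i j

open Classical in
theorem entry_weightIdempotent_mul (a : Composition n r) (x : Module.End K (TensorPow K n r))
    (i j : Fin r → Fin n) :
    entry K n r (weightIdempotent K a * x) i j =
      if weight i = a.1 then entry K n r x i j else 0 := by
  rw [entry_mul, Finset.sum_eq_single i]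
  · simp [entry_weightIdempotent]
  · intro k _ hk
    simp [entry_weightIdempotent, hk.symm]
  · simp

open Classical in
theorem entry_mul_weightIdempotent (a : Composition n r) (x : Module.End K (TensorPow K n r))
    (i j : Fin r → Fin n) :
    entry K n r (x * weightIdempotent K a) i j =
      if weight j = a.1 then entry K n r x i j else 0 := by
  rw [entry_mul, Finset.sum_eq_single j]
  · simp [entry_weightIdempotent]
  · intro k _ hk
    simp [entry_weightIdempotent, hk]
  · simp

/-- The idempotent of weight `a` acts on `x` as the identity, and it erases all rows of any other
weight. -/
theorem IsWeightVector.weight_eq {a : Composition n r} {x : borelSchur K n r}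
    (hx : IsWeightVector a x) {i j : Fin r → Fin n} (h : entry K n r x i j ≠ 0) :
    weight i = a.1 := by
  classical
  by_contra hi
  have h1 := congrArg (fun z : borelSchur K n r => entry K n r z i j) (hx (weightIdempotent K a))
  simp only [MulMemClass.coe_mul, entry_weightIdempotent_mul, if_neg hi] at h1
  rw [weightCharacter_apply, entry_weightIdempotent, if_pos ⟨rfl, weight_index a⟩, one_smul] at h1
  exact h h1.symm

/-- Every non-zero left ideal of the Borel-Schur algebra contains a weight vector. -/
theorem exists_mem_isWeightVector {N : Submodule (borelSchur K n r) (borelSchur K n r)}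
    (hN : N ≠ ⊥) : ∃ a, ∃ x ∈ N, x ≠ 0 ∧ IsWeightVector a x := by
  classical
  let height : (Fin r → Fin n) → ℕ := fun i => ∑ ρ, (i ρ : ℕ)
  have hlt : ∀ {i j : Fin r → Fin n}, i ≤ j → i ≠ j → height i < height j := by
    intro i j hij hne
    obtain ⟨ρ, hρ⟩ : ∃ ρ, i ρ ≠ j ρ := Function.ne_iff.1 hne
    exact Finset.sum_lt_sum (fun ρ _ => hij ρ) ⟨ρ, mem_univ _, lt_of_le_of_ne (hij ρ) (Fin.val_ne_of_ne hρ)⟩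
  -- A non-zero element of `N` is chosen whose non-zero rows have the least possible bound on their
  -- heights.
  have hex : ∃ m, ∃ x ∈ N, x ≠ 0 ∧ ∀ i j, entry K n r x i j ≠ 0 → height i ≤ m := by
    obtain ⟨x, hxN, hx0⟩ := N.ne_bot_iff.1 hN
    exact ⟨∑ i, height i, x, hxN, hx0, fun i j _ =>
      Finset.single_le_sum (f := height) (fun _ _ => Nat.zero_le _) (mem_univ i)⟩
  obtain ⟨x, hxN, hx0, hxm⟩ := Nat.find_spec hex
  -- An element with zero diagonal is strictly triangular and lowers that bound, so minimality makes
  -- the product zero.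
  have hkill : ∀ y : borelSchur K n r, (∀ i, entry K n r y i i = 0) → y * x = 0 := by
    intro y hy
    by_contra hyx
    have hbound : ∀ i j, entry K n r (y * x : borelSchur K n r) i j ≠ 0 →
        height i < Nat.find hex := by
      intro i j hij
      rw [MulMemClass.coe_mul, entry_mul] at hij
      obtain ⟨k, -, hk⟩ := Finset.exists_ne_zero_of_sum_ne_zero hij
      have hik : i ≤ k := by
        by_contra h
        exact left_ne_zero_of_mul hk (entry_eq_zero y.2 h)
      have hne : i ≠ k := by
        rintro rfl
        exact left_ne_zero_of_mul hk (hy i)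
      exact (hlt hik hne).trans_le (hxm k j (right_ne_zero_of_mul hk))
    have hpos : 0 < Nat.find hex := by
      by_contra h
      refine hyx (Subtype.ext (entry_ext fun i j => ?_))
      by_contra h'
      exact h ((Nat.zero_le _).trans_lt (hbound i j (by simpa using h')))
    exact Nat.find_min hex (Nat.sub_lt hpos one_pos)
      ⟨y * x, N.smul_mem y hxN, hyx, fun i j hij => Nat.le_sub_one_of_lt (hbound i j hij)⟩
  obtain ⟨i₀, j₀, h₀⟩ : ∃ i j, entry K n r x i j ≠ 0 := by
    by_contra! h
    exact hx0 (Subtype.ext (entry_ext fun i j => by simpa using h i j))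
  let a := weightComp i₀
  refine ⟨a, weightIdempotent K a * x, N.smul_mem _ hxN, fun h => h₀ ?_, fun y => ?_⟩
  · have := congrArg (fun z : borelSchur K n r => entry K n r z i₀ j₀) h
    simp only [MulMemClass.coe_mul, entry_weightIdempotent_mul] at this
    exact (if_pos rfl).symm.trans (this.trans (entry_zero _ _))
  -- On the rows of weight `a` the diagonal of `y` is constant, so `y * e_a - χ_a(y) • e_a` has zero
  -- diagonal, where `e_a` is the weight idempotent.
  · have h1 := hkill (y * weightIdempotent K a + (-weightCharacter K a y) • weightIdempotent K a)
      fun i => by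
        simp only [AddMemClass.coe_add, MulMemClass.coe_mul, SetLike.val_smul, entry_add,
          entry_mul_weightIdempotent, entry_smul, entry_weightIdempotent, true_and]
        split_ifs with hi
        · rw [weightCharacter_eq a y hi]
          ring
        · ring
    rw [add_mul, mul_assoc, smul_mul_assoc, neg_smul] at h1
    exact eq_of_sub_eq_zero (by rw [sub_eq_add_neg]; exact h1)

/-- The image of `L` contains the line spanned by a weight vector; both are simple, so they
coincide. -/
theorem exists_linearEquiv_weightModule {L : Type u} [AddCommGroup L] [Module (borelSchur K n r) L]
    [IsSimpleModule (borelSchur K n r) L] (f : L →ₗ[borelSchur K n r] borelSchur K n r)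
    (hf : Function.Injective f) :
    ∃ a, (∃ x : borelSchur K n r, x ≠ 0 ∧ IsWeightVector a x) ∧
      Nonempty (L ≃ₗ[borelSchur K n r] WeightModule K a) := by
  let e := LinearEquiv.ofInjective f hf
  have hs : IsSimpleModule (borelSchur K n r) (LinearMap.range f) := IsSimpleModule.congr e.symm
  have hne : LinearMap.range f ≠ ⊥ := (isSimpleModule_iff_isAtom.1 hs).1
  obtain ⟨a, x, hxN, hx0, hx⟩ := exists_mem_isWeightVector hne
  have := isSimpleModule_weightModule (K := K) a
  have hle : LinearMap.range hx.linearMap ≤ LinearMap.range f := by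
    rintro _ ⟨c, rfl⟩
    have : hx.linearMap c = ((show K from c) • (1 : borelSchur K n r)) • x := by
      change (show K from c) • x = _
      rw [smul_eq_mul, smul_mul_assoc, one_mul]
    rw [this]
    exact Submodule.smul_mem _ _ hxN
  let g : WeightModule K a →ₗ[borelSchur K n r] LinearMap.range f :=
    hx.linearMap.codRestrict _ fun c => hle ⟨c, rfl⟩
  have hg : g ≠ 0 := by
    intro h
    have h1 := congrArg Subtype.val (LinearMap.congr_fun h (show K from 1))
    exact hx0 ((one_smul K x).symm.trans h1)
  exact ⟨a, ⟨x, hx0, hx⟩,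
    ⟨e.trans (LinearEquiv.ofBijective g (LinearMap.bijective_of_ne_zero hg)).symm⟩⟩

end WeightVectors

end BorelSchur

namespace BorelSchur

/-! ### Relations from transvections, and why the weight is a partition -/

section Necessary

variable {K : Type u} [Field K] {n r : ℕ}

/-- `b` is obtained from `a` by replacing some occurrences of `s` by `t`. -/
noncomputable def Raises (s t : Fin n) (a b : Fin r → Fin n) : Prop :=
  ∀ ρ, a ρ = b ρ ∨ (a ρ = s ∧ b ρ = t)

variable (K r) in
/-- The action of the transvection `1 + E_{s,t}`. -/
noncomputable def transvectionAction {s t : Fin n} (h : s < t) : borelSchur K n r :=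
  ⟨tensorAction K n r (Matrix.GeneralLinearGroup.mkOfDetNeZero (Matrix.transvection s t (1 : K))
    (by rw [Matrix.det_transvection_of_ne s t h.ne]; exact one_ne_zero)), tensorAction_mem (by
      intro μ ν hμν
      simp only [id] at hμν
      change Matrix.transvection s t (1 : K) μ ν = 0
      rw [Matrix.transvection, Matrix.add_apply, Matrix.one_apply_ne hμν.ne', Matrix.single_apply,
        if_neg (by rintro ⟨rfl, rfl⟩; exact h.asymm hμν), add_zero])⟩

open Classical in
theorem entry_transvectionAction {s t : Fin n} (h : s < t) (a b : Fin r → Fin n) :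
    entry K n r (transvectionAction K r h) a b = if Raises s t a b then 1 else 0 := by
  have key : ∀ μ ν : Fin n, Matrix.transvection s t (1 : K) μ ν =
      if μ = ν ∨ (μ = s ∧ ν = t) then 1 else 0 := by
    intro μ ν
    rw [Matrix.transvection, Matrix.add_apply, Matrix.one_apply, Matrix.single_apply]
    by_cases h1 : μ = ν
    · subst h1
      rw [if_pos rfl, if_neg (by rintro ⟨rfl, rfl⟩; exact h.ne rfl), if_pos (Or.inl rfl), add_zero]
    · rw [if_neg h1, zero_add]
      exact if_congr (by rw [or_iff_right h1, eq_comm (a := s), eq_comm (a := t)]) rfl rfl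
  have h2 := entry_tensorAction K n r (Matrix.GeneralLinearGroup.mkOfDetNeZero
    (Matrix.transvection s t (1 : K))
    (by rw [Matrix.det_transvection_of_ne s t h.ne]; exact one_ne_zero)) a b
  refine h2.trans ?_
  change ∏ ρ, Matrix.transvection s t (1 : K) (a ρ) (b ρ) = _
  simp only [key, Raises]
  rw [Finset.prod_ite_zero]
  simp only [mem_univ, forall_true_left, prod_const_one]
  congr

theorem exists_entry_ne_zero {x : borelSchur K n r} (h : x ≠ 0) : ∃ i j, entry K n r x i j ≠ 0 := by
  by_contra! h'
  exact h (Subtype.ext (entry_ext fun i j => by simpa using h' i j))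

variable [Infinite K]

open Classical in
-- Row `i` of the transvection is the indicator of the raisings of `i`. Row `i` of `x` itself is
-- zero because its weight is not `a`, so the right-hand side of the eigenvector equation vanishes.
theorem IsWeightVector.sum_raises_eq_zero {a : Composition n r} {x : borelSchur K n r}
    (hx : IsWeightVector a x) {s t : Fin n} (h : s < t) {i : Fin r → Fin n}
    (hi : weight i t ≠ a t) (j : Fin r → Fin n) :
    ∑ b with Raises s t i b, entry K n r x b j = 0 := by
  have h1 := congrArg (fun z : borelSchur K n r => entry K n r z i j)
    (hx (transvectionAction K r h))
  have h2 : entry K n r x i j = 0 := by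
    by_contra h'
    exact hi (congrFun (hx.weight_eq h') t)
  simp only [MulMemClass.coe_mul, entry_mul, entry_transvectionAction, SetLike.val_smul,
    entry_smul, h2, mul_zero, ite_mul, one_mul, zero_mul] at h1
  rwa [Finset.sum_filter]

/-- The weight of a weight vector is a partition. -/
theorem IsWeightVector.antitone {a : Composition n r} {x : borelSchur K n r}
    (hx : IsWeightVector a x) (h0 : x ≠ 0) {s t : Fin n} (h : s < t) : a t ≤ a s := by
  classical
  obtain ⟨i, j, hij⟩ := exists_entry_ne_zero h0
  by_contra! hlt
  have hi := hx.weight_eq hij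
  let C : Finset (Fin r) := {ρ | i ρ = s}
  have hC : #C = a s := congrFun hi s
  -- All `s`- and `t`-places of `i` are reset to `s`, except those in `W`, which become `t`. For `W
  -- ⊆ C` this leaves at most `a s < a t` occurrences of `t`, so the transvection relation applies
  -- to `d W`.
  let d : Finset (Fin r) → Fin r → Fin n := fun W ρ =>
    if i ρ = s ∨ i ρ = t then (if ρ ∈ W then t else s) else i ρ
  have hd : ∀ W ∈ C.powerset, ∑ b with Raises s t (d W) b, entry K n r x b j = 0 := by
    intro W hW
    refine hx.sum_raises_eq_zero h (ne_of_lt (lt_of_le_of_lt ?_ hlt)) j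
    rw [← hC]
    refine Finset.card_le_card fun ρ hρ => ?_
    have hρ' := (mem_filter.1 hρ).2
    simp only [d] at hρ'
    by_contra hW'
    have : ρ ∉ W := fun h'' => hW' (mem_powerset.1 hW h'')
    rw [if_neg this] at hρ'
    split_ifs at hρ' with h1
    · exact h.ne hρ'
    · exact h1 (Or.inr hρ')
  have hiff : ∀ W ∈ C.powerset, ∀ b, Raises s t (d W) b ↔
      Raises s t (d ∅) b ∧ W ⊆ C.filter fun ρ => b ρ = t := by
    intro W hW b
    have hWC := mem_powerset.1 hW
    constructor
    · intro hr
      refine ⟨fun ρ => ?_, fun ρ hρ => ?_⟩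
      · have := hr ρ
        simp only [d, notMem_empty, if_false] at this ⊢
        split_ifs at this ⊢ with h1 h2
        · rcases this with h3 | h3
          · exact Or.inr ⟨rfl, h3.symm⟩
          · exact Or.inr ⟨rfl, h3.2⟩
        · exact this
        · exact this
      · have := hr ρ
        have hs : i ρ = s := (mem_filter.1 (hWC hρ)).2
        simp only [d, hs, true_or, if_true, hρ] at this
        refine mem_filter.2 ⟨hWC hρ, ?_⟩
        rcases this with h3 | h3
        · exact h3.symm
        · exact h3.2
    · rintro ⟨hr, hsub⟩ ρ
      have := hr ρ
      simp only [d, notMem_empty, if_false] at this ⊢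
      split_ifs at this ⊢ with h1 h2
      · exact Or.inl (mem_filter.1 (hsub h2)).2.symm
      · exact this
      · exact this
  -- The alternating sum over `W` isolates the raisings of `d ∅` that raise no place of `C`.
  have hsum : ∑ W ∈ C.powerset, (-1 : K) ^ #W *
      ∑ b with Raises s t (d W) b, entry K n r x b j = 0 :=
    Finset.sum_eq_zero fun W hW => by rw [hd W hW, mul_zero]
  have hcoef : ∀ b, ∑ W ∈ C.powerset, (if Raises s t (d W) b then (-1 : K) ^ #W else 0) =
      if Raises s t (d ∅) b ∧ (C.filter fun ρ => b ρ = t) = ∅ then 1 else 0 := by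
    intro b
    rw [Finset.sum_congr rfl fun W hW => if_congr (hiff W hW b) rfl rfl]
    by_cases hb : Raises s t (d ∅) b
    · simp only [hb, true_and]
      rw [← Finset.sum_filter]
      have : C.powerset.filter (fun W => W ⊆ C.filter fun ρ => b ρ = t) =
          (C.filter fun ρ => b ρ = t).powerset := by
        ext W
        simp only [mem_filter, mem_powerset]
        exact ⟨fun h => h.2, fun h => ⟨h.trans (filter_subset _ _), h⟩⟩
      rw [this]
      exact_mod_cast congrArg (Int.cast : ℤ → K)
        (Finset.sum_powerset_neg_one_pow_card (x := C.filter fun ρ => b ρ = t))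
    · simp [hb]
  have hswap : ∑ W ∈ C.powerset, (-1 : K) ^ #W *
      ∑ b with Raises s t (d W) b, entry K n r x b j =
      ∑ b, (if Raises s t (d ∅) b ∧ (C.filter fun ρ => b ρ = t) = ∅ then 1 else 0) *
        entry K n r x b j := by
    simp only [← hcoef, Finset.sum_filter, Finset.mul_sum, Finset.sum_mul]
    rw [Finset.sum_comm]
    refine Finset.sum_congr rfl fun b _ => Finset.sum_congr rfl fun W _ => ?_
    split_ifs <;> simp
  rw [hswap, Finset.sum_eq_single i] at hsum
  · rw [if_pos, one_mul] at hsum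
    · exact hij hsum
    · refine ⟨fun ρ => ?_, ?_⟩
      · simp only [d, notMem_empty, if_false]
        split_ifs with h1
        · rcases h1 with h1 | h1
          · exact Or.inl h1.symm
          · exact Or.inr ⟨rfl, h1⟩
        · exact Or.inl rfl
      · refine Finset.filter_eq_empty_iff.2 fun ρ hρ h' => h.ne ?_
        rw [← (mem_filter.1 hρ).2, h']
  -- A surviving `b` has its `t`-places among those of `i`. Both rows have weight `a`, hence equally
  -- many `t`'s, so `b = i` and the whole sum is the single entry at `(i, j)`.
  · intro b _ hb
    by_contra hne
    have hbx := right_ne_zero_of_mul hne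
    have hcond : Raises s t (d ∅) b ∧ (C.filter fun ρ => b ρ = t) = ∅ := by
      by_contra h'
      rw [if_neg h', zero_mul] at hne
      exact hne rfl
    obtain ⟨hr, he⟩ := hcond
    have hnt : ∀ ρ, i ρ = s → b ρ ≠ t := fun ρ hρ =>
      Finset.filter_eq_empty_iff.1 he (mem_filter.2 ⟨mem_univ _, hρ⟩)
    have hsub : (univ.filter fun ρ => b ρ = t) ⊆ univ.filter fun ρ => i ρ = t := by
      intro ρ hρ
      refine mem_filter.2 ⟨mem_univ _, ?_⟩
      have hbt := (mem_filter.1 hρ).2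
      have h3 := hr ρ
      have h4 : i ρ ≠ s := fun h' => hnt ρ h' hbt
      by_contra h5
      simp only [d, h4, h5, or_self, if_false, hbt] at h3
      simp at h3
    have hcard : #(univ.filter fun ρ => i ρ = t) ≤ #(univ.filter fun ρ => b ρ = t) := by
      have := congrFun ((hx.weight_eq hij).trans (hx.weight_eq hbx).symm) t
      exact this.le
    have heq := Finset.eq_of_subset_of_card_le hsub hcard
    apply hb
    funext ρ
    have h3 := hr ρ
    simp only [d, notMem_empty, if_false] at h3
    by_cases h4 : i ρ = t
    · have : ρ ∈ univ.filter fun ρ => b ρ = t := by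
        rw [heq]
        exact mem_filter.2 ⟨mem_univ _, h4⟩
      rw [h4, (mem_filter.1 this).2]
    · by_cases h5 : i ρ = s
      · rw [if_pos (Or.inl h5)] at h3
        rcases h3 with h3 | h3
        · rw [← h3, h5]
        · exact absurd h3.2 (hnt ρ h5)
      · rw [if_neg (by tauto)] at h3
        rcases h3 with h3 | h3
        · exact h3.symm
        · exact absurd h3.1 h5
  · simp

theorem IsWeightVector.isPartition {a : Composition n r} {x : borelSchur K n r}
    (hx : IsWeightVector a x) (h0 : x ≠ 0) : a.IsPartition := by
  intro μ ν h
  rcases h.eq_or_lt with rfl | h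
  · exact le_rfl
  · exact hx.antitone h0 h

end Necessary

end BorelSchur

namespace BorelSchur

/-! ### The condition on the last part of the weight -/

section LastPart

variable {n r : ℕ}

/-- The number of places with given values in a pair of multi-indices does not depend on which
places of a given kind are raised. -/
theorem card_raise_eq {s t : Fin n} (h : s ≠ t) {i j : Fin r → Fin n} {V W : Finset (Fin r)}
    (hV : V ⊆ univ.filter fun ρ => i ρ = s ∧ j ρ = t) (hW : W ⊆ univ.filter fun ρ => i ρ = s ∧ j ρ = t) (hVW : #V = #W)
    (q : Fin n × Fin n) :
    #{ρ | ((if ρ ∈ V then t else i ρ), j ρ) = q} =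
      #{ρ | ((if ρ ∈ W then t else i ρ), j ρ) = q} := by
  have key : ∀ V : Finset (Fin r), V ⊆ univ.filter (fun ρ => i ρ = s ∧ j ρ = t) →
      #{ρ | ((if ρ ∈ V then t else i ρ), j ρ) = q} =
        if q = (t, t) then #{ρ | (i ρ, j ρ) = q} + #V else
          if q = (s, t) then #{ρ | (i ρ, j ρ) = q} - #V else #{ρ | (i ρ, j ρ) = q} := by
    intro V hV
    have hV' : ∀ ρ ∈ V, i ρ = s ∧ j ρ = t := fun ρ hρ => (mem_filter.1 (hV hρ)).2
    split_ifs with h1 h2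
    · subst h1
      rw [← Finset.card_union_of_disjoint]
      · congr 1
        ext ρ
        simp only [mem_filter, mem_univ, true_and, mem_union, Prod.mk.injEq]
        by_cases hρ : ρ ∈ V
        · simp [hρ, (hV' ρ hρ).2]
        · simp [hρ]
      · rw [Finset.disjoint_left]
        intro ρ h3 h4
        have h5 := congrArg Prod.fst (mem_filter.1 h3).2
        exact h ((hV' ρ h4).1.symm.trans h5)
    · subst h2
      rw [← Finset.card_sdiff_of_subset (by simpa only [Prod.mk.injEq] using hV)]
      congr 1
      ext ρ
      simp only [mem_filter, mem_univ, true_and, mem_sdiff, Prod.mk.injEq]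
      by_cases hρ : ρ ∈ V
      · simp [hρ, h.symm]
      · simp [hρ]
    · congr 1
      ext ρ
      simp only [mem_filter, mem_univ, true_and]
      by_cases hρ : ρ ∈ V
      · simp only [hρ, if_true, (hV' ρ hρ).1, (hV' ρ hρ).2, Ne.symm h1, Ne.symm h2]
      · simp [hρ]
  rw [key V hV, key W hW, hVW]

variable {K : Type u} [Field K] [Infinite K]

/-- Lower `m` of the last-index places of a non-zero row to `s` and apply the transvection relation.
The terms that can be non-zero raise exactly `m` places among the `c + m` places with value `s`
below a `t` of `j`. By permutation invariance they are all equal, so the relation reads `(c +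
m).choose m` times a non-zero entry. -/
theorem IsWeightVector.exists_choose_eq_zero {a : Composition n r} {x : borelSchur K n r}
    (hx : IsWeightVector a x) (h0 : x ≠ 0) {s t : Fin n} (h : s < t) (ht : ∀ ν, ν ≤ t) :
    ∃ c ≤ a s, ∀ m, 0 < m → m ≤ a t → ((c + m).choose m : K) = 0 := by
  classical
  obtain ⟨i, j, hij⟩ := exists_entry_ne_zero h0
  have hi := hx.weight_eq hij
  have hle : ∀ {b : Fin r → Fin n}, entry K n r x b j ≠ 0 → b ≤ j := fun {b} hb => by
    by_contra h'
    exact hb (entry_eq_zero x.2 h')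
  have hjt : ∀ {b : Fin r → Fin n}, entry K n r x b j ≠ 0 → ∀ ρ, b ρ = t → j ρ = t :=
    fun hb ρ hρ => le_antisymm (ht _) (hρ ▸ hle hb ρ)
  refine ⟨#{ρ | i ρ = s ∧ j ρ = t}, ?_, fun m hm hmt => ?_⟩
  · rw [show a s = weight i s from (congrFun hi s).symm]
    exact Finset.card_le_card fun ρ hρ => mem_filter.2 ⟨mem_univ _, (mem_filter.1 hρ).2.1⟩
  have hit : #{ρ | i ρ = t} = a t := congrFun hi t
  obtain ⟨M, hM, hMm⟩ := Finset.exists_subset_card_eq (hmt.trans hit.ge)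
  have hM' : ∀ ρ ∈ M, i ρ = t := fun ρ hρ => (mem_filter.1 (hM hρ)).2
  let i' : Fin r → Fin n := fun ρ => if ρ ∈ M then s else i ρ
  let A : Finset (Fin r) := {ρ | i' ρ = s ∧ j ρ = t}
  let b : Finset (Fin r) → Fin r → Fin n := fun V ρ => if ρ ∈ V then t else i' ρ
  have hMA : M ⊆ A := fun ρ hρ => mem_filter.2 ⟨mem_univ _, by simp [i', hρ], hjt hij ρ (hM' ρ hρ)⟩
  have hA : #A = #{ρ | i ρ = s ∧ j ρ = t} + m := by
    rw [← hMm, ← Finset.card_union_of_disjoint]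
    · congr 1
      ext ρ
      simp only [A, i', mem_filter, mem_univ, true_and, mem_union]
      by_cases hρ : ρ ∈ M
      · simp [hρ, hjt hij ρ (hM' ρ hρ)]
      · simp [hρ]
    · rw [Finset.disjoint_left]
      intro ρ h1 h2
      exact h.ne ((mem_filter.1 h1).2.1.symm.trans (hM' ρ h2))
  have hbM : b M = i := by
    funext ρ
    simp only [b, i']
    split_ifs with hρ
    · exact (hM' ρ hρ).symm
    · rfl
  have hit' : #{ρ | i' ρ = t} + m = a t := by
    rw [← hit, ← hMm, ← Finset.card_union_of_disjoint]
    · congr 1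
      ext ρ
      simp only [i', mem_filter, mem_univ, true_and, mem_union]
      by_cases hρ : ρ ∈ M
      · simp [hρ, hM' ρ hρ]
      · simp [hρ]
    · rw [Finset.disjoint_left]
      intro ρ h1 h2
      have h3 := (mem_filter.1 h1).2
      simp only [i', h2, if_true] at h3
      exact h.ne h3
  -- Choosing `V` in place of `M` changes the pair of multi-indices only within its orbit.
  have hconst : ∀ V ∈ A.powersetCard m, entry K n r x (b V) j = entry K n r x i j := by
    intro V hV
    obtain ⟨hVA, hVm⟩ := mem_powersetCard.1 hV
    obtain ⟨π, hπ⟩ := exists_perm_comp_eq (fun ρ => (b V ρ, j ρ)) (fun ρ => (i ρ, j ρ)) fun q => by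
      rw [← hbM]
      exact card_raise_eq h.ne hVA hMA (hVm.trans hMm.symm) q
    have h1 : b V ∘ π = i := funext fun ρ => congrArg Prod.fst (congrFun hπ ρ)
    have h2 : j ∘ π = j := funext fun ρ => congrArg Prod.snd (congrFun hπ ρ)
    rw [← entry_comp_perm x.2 (b V) j π, h1, h2]
  have hmem : ∀ V ⊆ A, ∀ ρ, ρ ∈ V ↔ i' ρ = s ∧ b V ρ = t := by
    intro V hV ρ
    constructor
    · intro hρ
      exact ⟨(mem_filter.1 (hV hρ)).2.1, by simp [b, hρ]⟩
    · rintro ⟨h1, h2⟩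
      by_contra hρ
      simp only [b, hρ, if_false] at h2
      exact h.ne (h1.symm.trans h2)
  have hinj : Set.InjOn b (A.powersetCard m) := by
    intro V hV W hW hVW
    ext ρ
    rw [hmem V (mem_powersetCard.1 hV).1, hmem W (mem_powersetCard.1 hW).1, hVW]
  have hsum := hx.sum_raises_eq_zero h (i := i')
    (ne_of_lt ((Nat.lt_add_of_pos_right hm).trans_eq hit')) j
  rw [← Finset.sum_subset (s₁ := (A.powersetCard m).image b), Finset.sum_image hinj,
    Finset.sum_congr rfl hconst, Finset.sum_const, card_powersetCard, hA, nsmul_eq_mul] at hsum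
  · exact (mul_eq_zero.1 hsum).resolve_right hij
  · intro c hc
    obtain ⟨V, hV, rfl⟩ := mem_image.1 hc
    refine mem_filter.2 ⟨mem_univ _, fun ρ => ?_⟩
    by_cases hρ : ρ ∈ V
    · exact Or.inr ((hmem V (mem_powersetCard.1 hV).1 ρ).1 hρ)
    · exact Or.inl (by simp [b, hρ])
  -- A raising with a non-zero entry has `a t` places equal to `t`, so exactly `m` were raised;
  -- since it lies below `j`, they all lie in `A`.
  · intro c hc hc'
    have hr := (mem_filter.1 hc).2
    by_contra hne
    apply hc'
    have hdisj : Disjoint (univ.filter fun ρ => i' ρ = t) (univ.filter fun ρ => i' ρ = s ∧ c ρ = t) := by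
      rw [Finset.disjoint_left]
      intro ρ h1 h2
      exact h.ne ((mem_filter.1 h2).2.1.symm.trans (mem_filter.1 h1).2)
    have hunion : (univ.filter fun ρ => i' ρ = t) ∪ (univ.filter fun ρ => i' ρ = s ∧ c ρ = t) =
        univ.filter fun ρ => c ρ = t := by
      ext ρ
      simp only [mem_filter, mem_univ, true_and, mem_union]
      rcases hr ρ with h1 | h1
      · rw [h1]
        tauto
      · simp [h1.1, h1.2]
    have hcard := Finset.card_union_of_disjoint hdisj
    rw [hunion, show #{ρ | c ρ = t} = a t from congrFun (hx.weight_eq hne) t, ← hit'] at hcard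
    refine mem_image.2 ⟨univ.filter fun ρ => i' ρ = s ∧ c ρ = t, 
      mem_powersetCard.2 ⟨fun ρ hρ => ?_, by omega⟩, ?_⟩
    · have h1 := (mem_filter.1 hρ).2
      exact mem_filter.2 ⟨mem_univ _, h1.1, hjt hne ρ h1.2⟩
    · funext ρ
      simp only [b, mem_filter, mem_univ, true_and]
      rcases hr ρ with h1 | h1
      · split_ifs with h2
        · exact h2.2.symm
        · exact h1
      · rw [if_pos h1, h1.2]

/-- Lucas' theorem: each step strips a zero digit from `p ^ l` and the last digit from `c`. -/
theorem choose_prime_pow_modEq {p : ℕ} [Fact p.Prime] (l c : ℕ) :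
    c.choose (p ^ l) ≡ c / p ^ l [MOD p] := by
  induction l generalizing c with
  | zero => simpa using Nat.ModEq.refl c
  | succ l ih =>
    have hp : 0 < p := (Fact.out : p.Prime).pos
    have h1 := Choose.choose_modEq_choose_mod_mul_choose_div_nat (p := p) (n := c)
      (k := p ^ (l + 1))
    have h2 : p ^ (l + 1) / p = p ^ l := by rw [pow_succ, Nat.mul_div_cancel _ hp]
    have h3 : p ^ (l + 1) % p = 0 := by rw [pow_succ, Nat.mul_mod_left]
    rw [h2, h3, Nat.choose_zero_right, one_mul] at h1
    refine h1.trans ((ih (c / p)).trans ?_)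
    rw [Nat.div_div_eq_div_mul, pow_succ']

/-- Only `m = p ^ l` is needed. If `c + 1 = p ^ l * d`, then `(c + p ^ l).choose (p ^ l)` is
congruent to `d` modulo `p`, so `p` divides `d` and the power of `p` dividing `c + 1` goes up by
one. -/
theorem prime_pow_le_of_choose_modEq_zero {p : ℕ} [Fact p.Prime] {c k : ℕ} (hk : 0 < k)
    (h : ∀ m, 0 < m → m ≤ k → p ∣ (c + m).choose m) : p ^ (Nat.log p k + 1) - 1 ≤ c := by
  have hp : p.Prime := Fact.out
  have key : ∀ l ≤ Nat.log p k + 1, p ^ l ∣ c + 1 := by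
    intro l
    induction l with
    | zero => simp
    | succ l ih =>
      intro hl
      obtain ⟨d, hd⟩ := ih (by omega)
      have hpos : 0 < p ^ l := pow_pos hp.pos l
      have h1 := h (p ^ l) hpos (Nat.pow_le_of_le_log hk.ne' (by omega))
      have h2 := (Nat.modEq_zero_iff_dvd.2 h1).symm.trans (choose_prime_pow_modEq l (c + p ^ l))
      have hd0 : 0 < d := Nat.pos_of_ne_zero (by rintro rfl; simp at hd)
      have h3 : (c + p ^ l) / p ^ l = d := by
        rw [Nat.add_div_right _ hpos]
        have : c = (p ^ l - 1) + p ^ l * (d - 1) := by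
          have := Nat.mul_sub_one (p ^ l) d
          have := Nat.le_mul_of_pos_right (p ^ l) hd0
          omega
        rw [this, Nat.add_mul_div_left _ _ hpos, Nat.div_eq_of_lt (by omega)]
        omega
      rw [h3] at h2
      obtain ⟨e, rfl⟩ := Nat.modEq_zero_iff_dvd.1 h2.symm
      exact ⟨e, by rw [hd, pow_succ, mul_assoc]⟩
  have := Nat.le_of_dvd (Nat.succ_pos c) (key _ le_rfl)
  omega

theorem IsWeightVector.last_eq_zero [CharZero K] {a : Composition n r} {x : borelSchur K n r}
    (hx : IsWeightVector a x) (h0 : x ≠ 0) {s t : Fin n} (h : s < t) (ht : ∀ ν, ν ≤ t) :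
    a t = 0 := by
  obtain ⟨c, -, hc⟩ := hx.exists_choose_eq_zero h0 h ht
  by_contra h'
  have := hc 1 one_pos (Nat.one_le_iff_ne_zero.2 h')
  rw [Nat.choose_one_right] at this
  exact Nat.cast_ne_zero.2 c.succ_ne_zero this

theorem IsWeightVector.last_eq_zero_or (p : ℕ) [Fact p.Prime] [CharP K p] {a : Composition n r}
    {x : borelSchur K n r} (hx : IsWeightVector a x) (h0 : x ≠ 0) {s t : Fin n} (h : s < t)
    (ht : ∀ ν, ν ≤ t) : a t = 0 ∨ p ^ (Nat.log p (a t) + 1) - 1 ≤ a s := by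
  obtain ⟨c, hcs, hc⟩ := hx.exists_choose_eq_zero h0 h ht
  refine or_iff_not_imp_left.2 fun h' => (prime_pow_le_of_choose_modEq_zero
    (Nat.pos_of_ne_zero h') fun m hm hmt => ?_).trans hcs
  exact (CharP.cast_eq_zero_iff K p _).1 (hc m hm hmt)

end LastPart

end BorelSchur

/-- A function that is invariant under a permutation of `p`-power order and vanishes on its fixed
points has sum zero in characteristic `p`. -/
theorem sum_eq_zero_of_perm_pow_eq_one {α K : Type*} [Fintype α] [DecidableEq α] [Field K] (p : ℕ)
    [Fact p.Prime] [CharP K p] (f : Equiv.Perm α) {N : ℕ} (hf : f ^ p ^ N = 1) (F : α → K)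
    (hF : ∀ x, F (f x) = F x) (h0 : ∀ x, f x = x → F x = 0) : ∑ x, F x = 0 := by
  classical
  -- The sum is grouped by values of `F`. Each level set of a non-zero value is stable under `f` and
  -- has no fixed points, so its size is divisible by `p`.
  have hsum := Finset.sum_comp (fun c : K => c) F (s := univ)
  refine hsum.trans (Finset.sum_eq_zero fun c _ => ?_)
  by_cases hc : c = 0
  · rw [hc, smul_zero]
  let g : Function.End {x // F x = c} := fun x => ⟨f x, by rw [hF, x.2]⟩
  have hg : ∀ k : ℕ, ∀ x, ((g ^ k) x).1 = (f ^ k) x.1 := by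
    intro k
    induction k with
    | zero => intro x; rfl
    | succ k ih =>
      intro x
      rw [pow_succ, pow_succ]
      exact ih (g x)
  have hg1 : g ^ p ^ N = 1 := by
    funext x
    refine Subtype.ext ?_
    rw [hg, hf]
    rfl
  have hcard := Equiv.Perm.card_fixedPoints_modEq hg1
  have hempty : IsEmpty (Function.fixedPoints g) :=
    ⟨fun x => hc (x.1.2.symm.trans (h0 _ (congrArg Subtype.val x.2)))⟩
  rw [Fintype.card_eq_zero (α := Function.fixedPoints g), Fintype.card_subtype] at hcard
  rw [nsmul_eq_mul, (CharP.cast_eq_zero_iff K p _).2 (Nat.modEq_zero_iff_dvd.1 hcard), zero_mul]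

/-- A cycle through `s`: a multi-index invariant under it must be constant on `s`, and its order is
a power of `p` when `#s` is. -/
theorem exists_perm_transitive_on {α : Type*} [Fintype α] [DecidableEq α] (s : Finset α) :
    ∃ σ : Equiv.Perm α, σ ^ #s = 1 ∧ (∀ x ∉ s, σ x = x) ∧
      ∀ x ∈ s, ∀ y ∈ s, ∃ m : ℕ, (σ ^ m) x = y := by
  obtain ⟨σ, hσ, hs⟩ := s.exists_cycleOn
  have hfix : ∀ x ∉ s, σ x = x := fun x hx => by
    by_contra h
    exact hx (hs (Equiv.Perm.mem_support.2 h))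
  refine ⟨σ, Equiv.ext fun x => ?_, hfix, fun x hx y hy => ?_⟩
  · by_cases hx : x ∈ s
    · exact hσ.pow_card_apply hx
    · exact Equiv.Perm.pow_apply_eq_self_of_apply_eq_self (hfix x hx) _
  · obtain ⟨m, -, hm⟩ := hσ.exists_pow_eq hx hy
    exact ⟨m, hm⟩

theorem comp_eq_self_of_const {α β : Type*} {σ : Equiv.Perm α} {s : Finset α}
    (h : ∀ x ∉ s, σ x = x) {f : α → β} {c : β} (hf : ∀ x ∈ s, f x = c) : f ∘ σ = f := by
  funext x
  by_cases hx : x ∈ s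
  · have : σ x ∈ s := by
      by_contra h'
      exact h' ((σ.injective (h _ h')).symm ▸ hx)
    exact (hf _ this).trans (hf x hx).symm
  · exact congrArg f (h x hx)

theorem apply_pow_of_comp_eq_self {α β : Type*} {σ : Equiv.Perm α} {f : α → β} (h : f ∘ σ = f)
    (m : ℕ) (x : α) : f ((σ ^ m) x) = f x := by
  induction m with
  | zero => rfl
  | succ m ih =>
    rw [pow_succ', Equiv.Perm.mul_apply, ← ih]
    exact congrFun h _

namespace BorelSchur

/-! ### Vanishing sums in characteristic `p` -/

section Blocks

variable {n r : ℕ} {K : Type u} [Field K]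
variable (p : ℕ) [Fact p.Prime] [CharP K p] {a : Composition n r} {i j : Fin r → Fin n}

open Classical in
-- Precomposition with `σ` permutes the range of summation and preserves the summands because `σ`
-- fixes `i` and `j`; it has no fixed points there.
theorem sum_entry_eq_zero_of_perm {σ : Equiv.Perm (Fin r)} {N : ℕ} (hσ : σ ^ p ^ N = 1)
    (hi : i ∘ σ = i) (hj : j ∘ σ = j)
    (hfix : ∀ b : Fin r → Fin n, i ≤ b → b ≤ j → weight b = a.1 → b ∘ σ ≠ b)
    (y : borelSchur K n r) :
    ∑ b with i ≤ b ∧ b ≤ j ∧ weight b = a.1, entry K n r y i b = 0 := by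
  let f : Equiv.Perm (Fin r → Fin n) := Equiv.arrowCongr σ.symm (Equiv.refl _)
  have hfa : ∀ b, f b = b ∘ σ := fun b => rfl
  have hfk : ∀ k : ℕ, ∀ b, (f ^ k) b = b ∘ (σ ^ k : Equiv.Perm _) := by
    intro k
    induction k with
    | zero => intro b; rfl
    | succ k ih =>
      intro b
      rw [pow_succ, Equiv.Perm.mul_apply, ih, hfa, pow_succ']
      rfl
  have hcomp : ∀ b c : Fin r → Fin n, b ∘ σ ≤ c ∘ σ ↔ b ≤ c := fun b c =>
    ⟨fun h ρ => by simpa using h (σ.symm ρ), fun h ρ => h (σ ρ)⟩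
  rw [Finset.sum_filter]
  refine sum_eq_zero_of_perm_pow_eq_one p f (N := N) (Equiv.ext fun b => ?_) _ (fun b => ?_)
    fun b hb => ?_
  · rw [hfk, hσ]
    rfl
  · have h1 : i ≤ b ∘ σ ↔ i ≤ b := by rw [← hcomp i b, hi]
    have h2 : b ∘ σ ≤ j ↔ b ≤ j := by rw [← hcomp b j, hj]
    have h3 : entry K n r y i (b ∘ σ) = entry K n r y i b := by
      rw [← entry_comp_perm y.2 i b σ, hi]
    simp only [hfa, h1, h2, h3, weight_comp_perm]
  · exact if_neg fun h => hfix b h.1 h.2.1 h.2.2 hb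

open Classical in
theorem sum_entry_eq_zero_of_block {s : Finset (Fin r)} {N : ℕ} (hs : #s = p ^ N) {κ ν : Fin n}
    (hi : ∀ ρ ∈ s, i ρ = κ) (hj : ∀ ρ ∈ s, j ρ = ν)
    (hno : ∀ b : Fin r → Fin n, i ≤ b → b ≤ j → weight b = a.1 → ∀ μ, ¬ ∀ ρ ∈ s, b ρ = μ)
    (y : borelSchur K n r) :
    ∑ b with i ≤ b ∧ b ≤ j ∧ weight b = a.1, entry K n r y i b = 0 := by
  obtain ⟨σ, hσ, hfix, htrans⟩ := exists_perm_transitive_on s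
  have hne : s.Nonempty := Finset.card_pos.1 (hs ▸ pow_pos (Fact.out : p.Prime).pos N)
  obtain ⟨ρ₀, hρ₀⟩ := hne
  refine sum_entry_eq_zero_of_perm p (hs ▸ hσ) (comp_eq_self_of_const hfix hi)
    (comp_eq_self_of_const hfix hj) (fun b h1 h2 h3 h4 => hno b h1 h2 h3 (b ρ₀) fun ρ hρ => ?_) y
  obtain ⟨m, hm⟩ := htrans ρ₀ hρ₀ ρ hρ
  rw [← hm, apply_pow_of_comp_eq_self h4]

open Classical in
-- A product of disjoint cycles still has `p`-power order, while its invariants must be constant on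
-- both blocks at once. This is weaker to exclude than constancy on a single block.
theorem sum_entry_eq_zero_of_two_blocks {s t : Finset (Fin r)} {N : ℕ} (hs : #s = p ^ N)
    (ht : #t = p ^ N) (hst : Disjoint s t) {κ ν : Fin n}
    (hi : ∀ ρ ∈ s ∪ t, i ρ = κ) (hj : ∀ ρ ∈ s ∪ t, j ρ = ν)
    (hno : ∀ b : Fin r → Fin n, i ≤ b → b ≤ j → weight b = a.1 →
      ∀ μ μ', (∀ ρ ∈ s, b ρ = μ) → ¬ ∀ ρ ∈ t, b ρ = μ')
    (y : borelSchur K n r) :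
    ∑ b with i ≤ b ∧ b ≤ j ∧ weight b = a.1, entry K n r y i b = 0 := by
  obtain ⟨σ, hσ, hfix, htrans⟩ := exists_perm_transitive_on s
  obtain ⟨τ, hτ, hfix', htrans'⟩ := exists_perm_transitive_on t
  have hpos := pow_pos (Fact.out : p.Prime).pos N
  obtain ⟨ρ₀, hρ₀⟩ : s.Nonempty := Finset.card_pos.1 (hs ▸ hpos)
  obtain ⟨ρ₁, hρ₁⟩ : t.Nonempty := Finset.card_pos.1 (ht ▸ hpos)
  have hdisj : Equiv.Perm.Disjoint σ τ := fun ρ => by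
    by_cases h : ρ ∈ s
    · exact Or.inr (hfix' ρ (Finset.disjoint_left.1 hst h))
    · exact Or.inl (hfix ρ h)
  have hpow : ∀ m, (σ * τ) ^ m = σ ^ m * τ ^ m := hdisj.commute.mul_pow
  have hpow' : ∀ m, (σ * τ) ^ m = τ ^ m * σ ^ m := fun m => by
    rw [hdisj.commute.eq, hdisj.commute.symm.mul_pow]
  have hfixu : ∀ ρ ∉ s ∪ t, (σ * τ) ρ = ρ := fun ρ hρ => by
    rw [mem_union, not_or] at hρ
    rw [Equiv.Perm.mul_apply, hfix' ρ hρ.2, hfix ρ hρ.1]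
  refine sum_entry_eq_zero_of_perm p (σ := σ * τ) (N := N) ?_ (comp_eq_self_of_const hfixu hi)
    (comp_eq_self_of_const hfixu hj) (fun b h1 h2 h3 h4 =>
      hno b h1 h2 h3 (b ρ₀) (b ρ₁) (fun ρ hρ => ?_) fun ρ hρ => ?_) y
  · rw [hpow, ← hs, hσ, hs, ← ht, hτ, one_mul]
  · obtain ⟨m, hm⟩ := htrans ρ₀ hρ₀ ρ hρ
    rw [← apply_pow_of_comp_eq_self h4 m ρ₀, hpow, Equiv.Perm.mul_apply,
      Equiv.Perm.pow_apply_eq_self_of_apply_eq_self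
        (hfix' ρ₀ (Finset.disjoint_left.1 hst hρ₀)), hm]
  · obtain ⟨m, hm⟩ := htrans' ρ₁ hρ₁ ρ hρ
    rw [← apply_pow_of_comp_eq_self h4 m ρ₁, hpow', Equiv.Perm.mul_apply,
      Equiv.Perm.pow_apply_eq_self_of_apply_eq_self
        (hfix ρ₁ (Finset.disjoint_right.1 hst hρ₁)), hm]

end Blocks

/-! ### Box elements as weight vectors -/

section Sufficient

variable {n r : ℕ} {K : Type u} [Field K] [Infinite K]

open Classical in
variable (K) in
/-- The sum of all distinct basis elements `ξ_{i,j}` with `i ≤ j`, `i` of weight `a` and `j` of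
weight `μ`. -/
noncomputable def boxElement (a μ : Composition n r) : borelSchur K n r :=
  ofMatrix (Matrix.of fun i j => if i ≤ j ∧ weight i = a.1 ∧ weight j = μ.1 then 1 else 0)
    (fun i j π => by
      have : i ∘ π ≤ j ∘ π ↔ i ≤ j :=
        ⟨fun h ρ => by simpa using h (π.symm ρ), fun h ρ => h (π ρ)⟩
      simp only [Matrix.of_apply, this, weight_comp_perm])
    (fun i j h => if_neg fun h' => h h'.1)

open Classical in
theorem entry_boxElement (a μ : Composition n r) (i j : Fin r → Fin n) :
    entry K n r (boxElement K a μ) i j =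
      if i ≤ j ∧ weight i = a.1 ∧ weight j = μ.1 then 1 else 0 :=
  entry_ofMatrix _ _ _ i j

theorem boxElement_ne_zero {i j : Fin r → Fin n} (h : i ≤ j) :
    boxElement K (weightComp i) (weightComp j) ≠ 0 := by
  classical
  intro h0
  have h1 := congrArg (fun z : borelSchur K n r => entry K n r z i j) h0
  have h2 := entry_boxElement (K := K) (weightComp i) (weightComp j) i j
  have h3 := (if_pos (⟨h, rfl, rfl⟩ : i ≤ j ∧ weight i = (weightComp i).1 ∧
    weight j = (weightComp j).1)).symm.trans (h2.symm.trans h1)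
  exact one_ne_zero (α := K) (h3.trans (entry_zero i j))

open Classical in
-- The entry of `y` times the box element at `(i, j)` is the sum in `H`. If `i` has weight `a`, only
-- `b = i` contributes and gives the character value; if it has another weight, the sum has to
-- vanish.
theorem isWeightVector_boxElement {a μ : Composition n r}
    (H : ∀ i j b₀ : Fin r → Fin n, i ≤ b₀ → b₀ ≤ j → weight b₀ = a.1 → weight j = μ.1 →
      weight i ≠ a.1 → ∀ y : borelSchur K n r,
        ∑ b with i ≤ b ∧ b ≤ j ∧ weight b = a.1, entry K n r y i b = 0) :
    IsWeightVector a (boxElement K a μ) := by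
  intro y
  refine Subtype.ext (entry_ext fun i j => ?_)
  rw [MulMemClass.coe_mul, SetLike.val_smul, entry_mul, entry_smul]
  simp only [entry_boxElement]
  have hsum : ∑ b, entry K n r y i b *
      (if b ≤ j ∧ weight b = a.1 ∧ weight j = μ.1 then (1 : K) else 0) =
      if weight j = μ.1 then ∑ b with i ≤ b ∧ b ≤ j ∧ weight b = a.1, entry K n r y i b else 0 := by
    split_ifs with hj
    · rw [Finset.sum_filter]
      refine Finset.sum_congr rfl fun b _ => ?_
      by_cases hib : i ≤ b
      · simp only [hib, true_and, hj, and_true]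
        split_ifs <;> simp
      · simp [hib, entry_eq_zero y.2 hib]
    · simp [hj]
  rw [hsum]
  by_cases hj : weight j = μ.1
  · rw [if_pos hj]
    by_cases hi : weight i = a.1
    · by_cases hij : i ≤ j
      · rw [if_pos ⟨hij, hi, hj⟩, mul_one, weightCharacter_eq a y hi]
        refine Finset.sum_eq_single_of_mem i (mem_filter.2 ⟨mem_univ _, le_rfl, hij, hi⟩) ?_
        intro b hb hne
        obtain ⟨-, h1, -, h2⟩ := mem_filter.1 hb
        exact absurd (eq_of_le_of_weight_eq h1 (hi.trans h2.symm)).symm hne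
      · rw [if_neg fun h => hij h.1, mul_zero]
        refine Finset.sum_eq_zero fun b hb => ?_
        obtain ⟨-, h1, h2, -⟩ := mem_filter.1 hb
        exact absurd (h1.trans h2) hij
    · rw [if_neg fun h => hi h.2.1, mul_zero]
      by_contra hne
      obtain ⟨b, hb, -⟩ := Finset.exists_ne_zero_of_sum_ne_zero hne
      obtain ⟨-, h1, h2, h3⟩ := mem_filter.1 hb
      exact hne (H i j b h1 h2 h3 hj hi y)
  · rw [if_neg hj, if_neg fun h => hj h.2.2, mul_zero]

theorem exists_isWeightVector_topWeight [NeZero n] :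
    ∃ x : borelSchur K n r, x ≠ 0 ∧ IsWeightVector (topWeight n r) x := by
  classical
  have hw : weightComp (fun _ : Fin r => (0 : Fin n)) = topWeight n r := by
    refine Subtype.ext (funext fun ν => ?_)
    change #{ρ : Fin r | (0 : Fin n) = ν} = Pi.single (M := fun _ => ℕ) 0 r ν
    by_cases h : ν = 0
    · subst h
      simp
    · simp [Ne.symm h, h]
  refine ⟨boxElement K (topWeight n r) (topWeight n r), ?_, isWeightVector_boxElement ?_⟩
  · rw [← hw]
    exact boxElement_ne_zero le_rfl
  · intro i j b hib hbj _ hj hi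
    rw [← hw] at hj
    obtain ⟨π, hπ⟩ := exists_perm_of_weight_eq (i := fun _ : Fin r => (0 : Fin n)) hj.symm
    refine absurd ?_ hi
    have : i = fun _ => 0 := funext fun ρ =>
      nonpos_iff_eq_zero.1 (((hib.trans hbj) ρ).trans_eq (congrFun hπ ρ).symm)
    rw [this]
    exact congrArg Subtype.val hw


end Sufficient

end BorelSchur

namespace BorelSchur

/-! ### Columns with only the smallest and the largest value -/

section Existence

variable {n r : ℕ} [NeZero n] {K : Type u} [Field K]

theorem card_filter_add_weight_zero {i j : Fin r → Fin n} (hij : i ≤ j) {t : Fin n} (ht : t ≠ 0)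
    (hj : ∀ ρ, j ρ = 0 ∨ j ρ = t) : #{ρ | i ρ = 0 ∧ j ρ = t} + weight j 0 = weight i 0 := by
  rw [weight, weight, ← Finset.card_union_of_disjoint]
  · congr 1
    ext ρ
    simp only [mem_union, mem_filter, mem_univ, true_and]
    constructor
    · rintro (h | h)
      · exact h.1
      · exact nonpos_iff_eq_zero.1 ((hij ρ).trans_eq h)
    · intro h
      rcases hj ρ with h' | h'
      · exact Or.inr h'
      · exact Or.inl ⟨h, h'⟩
  · rw [Finset.disjoint_left]
    intro ρ h1 h2
    exact ht ((mem_filter.1 h1).2.2.symm.trans (mem_filter.1 h2).2)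

theorem weight_zero_le {i j : Fin r → Fin n} (hij : i ≤ j) : weight j 0 ≤ weight i 0 :=
  Finset.card_le_card fun ρ hρ => mem_filter.2 ⟨mem_univ _,
    nonpos_iff_eq_zero.1 ((hij ρ).trans_eq (mem_filter.1 hρ).2)⟩

open Classical in
-- If `i` has more than `a 0` zeros, at least `p ^ N` of them lie below a `t` of `j`, and these
-- provide a block on which no `b` of weight `a` is constant.
theorem sum_entry_eq_zero_of_lt_weight_zero (p : ℕ) [Fact p.Prime] [CharP K p]
    {a : Composition n r} {i j : Fin r → Fin n} (hij : i ≤ j) {t : Fin n} (ht : t ≠ 0)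
    (hj : ∀ ρ, j ρ = 0 ∨ j ρ = t) {N : ℕ} (hj0 : weight j 0 + p ^ N = a 0 + 1)
    (hlt : a 0 < weight i 0) (hsmall : ∀ ν, ν ≠ 0 → a ν < p ^ N) (y : borelSchur K n r) :
    ∑ b with i ≤ b ∧ b ≤ j ∧ weight b = a.1, entry K n r y i b = 0 := by
  have hcard := card_filter_add_weight_zero hij ht hj
  obtain ⟨s, hs, hsN⟩ := Finset.exists_subset_card_eq
    (s := univ.filter fun ρ => i ρ = 0 ∧ j ρ = t) (n := p ^ N) (by omega)
  have hs' : ∀ ρ ∈ s, i ρ = 0 ∧ j ρ = t := fun ρ hρ => (mem_filter.1 (hs hρ)).2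
  refine sum_entry_eq_zero_of_block p hsN (fun ρ hρ => (hs' ρ hρ).1) (fun ρ hρ => (hs' ρ hρ).2)
    (fun b _ hbj hb μ hμ => ?_) y
  by_cases h0 : μ = 0
  · subst h0
    -- Zeros of `j` are zeros of `b`; with the block they would give `a 0 + 1` zeros, one too many.
    have hdisj : Disjoint s (univ.filter fun ρ => j ρ = 0) := by
      rw [Finset.disjoint_left]
      intro ρ h1 h2
      exact ht ((hs' ρ h1).2.symm.trans (mem_filter.1 h2).2)
    have hle : #(s ∪ univ.filter fun ρ => j ρ = 0) ≤ #(univ.filter fun ρ => b ρ = 0) := by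
      refine Finset.card_le_card fun ρ hρ => mem_filter.2 ⟨mem_univ _, ?_⟩
      rcases mem_union.1 hρ with h | h
      · exact hμ ρ h
      · exact nonpos_iff_eq_zero.1 ((hbj ρ).trans_eq (mem_filter.1 h).2)
    rw [Finset.card_union_of_disjoint hdisj, hsN] at hle
    have h1 : #(univ.filter fun ρ => b ρ = 0) = a 0 := congrFun hb 0
    have h2 : #(univ.filter fun ρ => j ρ = 0) = weight j 0 := rfl
    omega
  · have hle : #s ≤ #(univ.filter fun ρ => b ρ = μ) :=
      Finset.card_le_card fun ρ hρ => mem_filter.2 ⟨mem_univ _, hμ ρ hρ⟩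
    have h1 : #(univ.filter fun ρ => b ρ = μ) = a μ := congrFun hb μ
    have := hsmall μ h0
    omega

open Classical in
theorem exists_isWeightVector_of_sum_eq_zero [Infinite K] {a : Composition n r} {t : Fin n}
    (ht : t ≠ 0) (htop : ∀ ν, ν ≤ t) {P : ℕ} (hP : 0 < P) (hPa : P - 1 ≤ a 0)
    (H : ∀ i j b₀ : Fin r → Fin n, i ≤ b₀ → b₀ ≤ j → weight b₀ = a.1 →
      (∀ ρ, j ρ = 0 ∨ j ρ = t) → weight j 0 + P = a 0 + 1 → weight i ≠ a.1 →
      ∀ y : borelSchur K n r,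
        ∑ b with i ≤ b ∧ b ≤ j ∧ weight b = a.1, entry K n r y i b = 0) :
    ∃ x : borelSchur K n r, x ≠ 0 ∧ IsWeightVector a x := by
  have ha : weightComp a.index = a := Subtype.ext (weight_index a)
  have ha0 : #(univ.filter fun ρ => a.index ρ = 0) = a 0 := congrFun (weight_index a) 0
  -- Keeping all but `P - 1` of the zeros, and raising everything else to `t`, leaves `a 0 + 1 - P`
  -- zeros in the column.
  obtain ⟨T, hT, hTP⟩ := Finset.exists_subset_card_eq (hPa.trans ha0.ge)
  let j₀ : Fin r → Fin n := fun ρ => if a.index ρ = 0 ∧ ρ ∉ T then 0 else t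
  have hle : a.index ≤ j₀ := fun ρ => by
    simp only [j₀]
    split_ifs with h
    · exact h.1.le
    · exact htop _
  have hw : weight j₀ 0 + P = a 0 + 1 := by
    have h1 : weight j₀ 0 = #((univ.filter fun ρ => a.index ρ = 0) \ T) := by
      rw [weight]
      congr 1
      ext ρ
      simp only [j₀, mem_filter, mem_univ, true_and, mem_sdiff]
      split_ifs with h
      · simp [h]
      · simp [h, ht]
    rw [h1, Finset.card_sdiff_of_subset hT, ha0, hTP]
    omega
  refine ⟨boxElement K a (weightComp j₀), ?_, isWeightVector_boxElement ?_⟩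
  · have := boxElement_ne_zero (K := K) hle
    rwa [ha] at this
  · intro i j b hib hbj hb hj hi
    obtain ⟨π, hπ⟩ := exists_perm_of_weight_eq (i := j₀) (j := j) hj.symm
    refine H i j b hib hbj hb (fun ρ => ?_) ?_ hi
    · rw [← hπ]
      simp only [Function.comp_apply, j₀]
      split_ifs
      · exact Or.inl rfl
      · exact Or.inr rfl
    · rw [← hw, show weight j = weight j₀ from hj]

end Existence

/-! ### Existence for two and three parts -/

section TwoAndThree

variable {r : ℕ} {K : Type u} [Field K] [Infinite K]

theorem exists_isWeightVector_two (p : ℕ) [Fact p.Prime] [CharP K p] {a : Composition 2 r}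
    (ha : p ^ (Nat.log p (a 1) + 1) - 1 ≤ a 0) :
    ∃ x : borelSchur K 2 r, x ≠ 0 ∧ IsWeightVector a x := by
  have hp : p.Prime := Fact.out
  refine exists_isWeightVector_of_sum_eq_zero (t := 1) (by decide) (fun ν => by omega)
    (pow_pos hp.pos _) ha fun i j b hib hbj hb hj hj0 hi =>
      sum_entry_eq_zero_of_lt_weight_zero p (hib.trans hbj) (by decide) hj hj0 ?_ fun ν hν => ?_
  · refine lt_of_le_of_ne ((congrFun hb 0).symm.trans_le (weight_zero_le hib)) fun h => hi ?_
    have h1 := sum_weight i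
    have h2 := a.2
    rw [Fin.sum_univ_two] at h1 h2
    funext ν
    fin_cases ν
    · exact h.symm
    · change weight i 1 = a 1
      omega
  · obtain rfl : ν = 1 := by omega
    exact Nat.lt_pow_succ_log_self hp.one_lt _

/-- Put `q = p ^ (log_p (a 2) + 1)`. A row with more than `a 0` zeros is handled by a block of `p *
q` places. A row with exactly `a 0` zeros has at least `2 * q` ones; on two blocks of `q` of these,
`b` cannot be constant with value 2 since `a 2 < q`, nor equal to 1 on both since `a 1 = 2 * q - 1`.
-/
theorem exists_isWeightVector_three (p : ℕ) [Fact p.Prime] [CharP K p] (hp3 : 3 ≤ p)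
    {a : Composition 3 r} (h0 : p ^ (Nat.log p (a 2) + 2) - 1 ≤ a 0)
    (h1 : a 1 = 2 * p ^ (Nat.log p (a 2) + 1) - 1) :
    ∃ x : borelSchur K 3 r, x ≠ 0 ∧ IsWeightVector a x := by
  classical
  have hp : p.Prime := Fact.out
  have hq : 0 < p ^ (Nat.log p (a 2) + 1) := pow_pos hp.pos _
  have h2 : a 2 < p ^ (Nat.log p (a 2) + 1) := Nat.lt_pow_succ_log_self hp.one_lt _
  have hpq : 3 * p ^ (Nat.log p (a 2) + 1) ≤ p ^ (Nat.log p (a 2) + 2) := by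
    rw [pow_succ' p (Nat.log p (a 2) + 1)]
    exact Nat.mul_le_mul_right _ hp3
  refine exists_isWeightVector_of_sum_eq_zero (t := 2) (by decide) (fun ν => by omega)
    (pow_pos hp.pos _) h0 fun i j b hib hbj hb hj hj0 hi => ?_
  have hle : a 0 ≤ weight i 0 := (congrFun hb 0).symm.trans_le (weight_zero_le hib)
  rcases hle.lt_or_eq with hlt | heq
  · refine sum_entry_eq_zero_of_lt_weight_zero p (hib.trans hbj) (by decide) hj hj0 hlt
      fun ν hν => ?_
    fin_cases ν
    · exact absurd rfl hν
    · change a 1 < _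
      omega
    · change a 2 < _
      omega
  · have hi2 : weight i 2 ≤ a 2 := by
      rw [← show weight b 2 = a 2 from congrFun hb 2]
      refine Finset.card_le_card fun ρ hρ => mem_filter.2 ⟨mem_univ _, ?_⟩
      have h3 := hib ρ
      rw [(mem_filter.1 hρ).2] at h3
      exact le_antisymm (Fin.le_last _) h3
    -- The zeros agree and `i` has at most `a 2` twos, so it has at least `a 1` ones; equality would
    -- give `i` weight `a`.
    have hi1 : 2 * p ^ (Nat.log p (a 2) + 1) ≤ weight i 1 := by
      have h3 := sum_weight i
      have h4 := a.2
      rw [Fin.sum_univ_three] at h3 h4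
      by_contra hcon
      apply hi
      funext ν
      fin_cases ν
      · exact heq.symm
      · change weight i 1 = a 1
        omega
      · change weight i 2 = a 2
        omega
    obtain ⟨S, hS, hScard⟩ := Finset.exists_subset_card_eq
      (s := univ.filter fun ρ => i ρ = 1) hi1
    obtain ⟨s, hs, hscard⟩ := Finset.exists_subset_card_eq (s := S)
      (n := p ^ (Nat.log p (a 2) + 1)) (by omega)
    have hunion : s ∪ S \ s = S := Finset.union_sdiff_of_subset hs
    have hi' : ∀ ρ ∈ S, i ρ = 1 := fun ρ hρ => (mem_filter.1 (hS hρ)).2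
    have hj' : ∀ ρ ∈ S, j ρ = 2 := fun ρ hρ => by
      have h3 := (hib.trans hbj) ρ
      rw [hi' ρ hρ] at h3
      rcases hj ρ with h4 | h4
      · rw [h4] at h3
        exact absurd h3 (Nat.not_succ_le_zero 0)
      · exact h4
    refine sum_entry_eq_zero_of_two_blocks p hscard (t := S \ s)
      (by rw [Finset.card_sdiff_of_subset hs]; omega) Finset.disjoint_sdiff
      (by rw [hunion]; exact hi') (by rw [hunion]; exact hj') fun c hic _ hc μ μ' hμ hμ' => ?_
    have hcount : ∀ ν : Fin 3, #(univ.filter fun ρ => c ρ = ν) = a ν := fun ν => congrFun hc ν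
    have hone : ∀ (T : Finset (Fin r)) (κ : Fin 3), T ⊆ S →
        #T = p ^ (Nat.log p (a 2) + 1) → (∀ ρ ∈ T, c ρ = κ) → κ = 1 := by
      intro T κ hTS hT hκ
      obtain ⟨ρ, hρ⟩ : T.Nonempty := Finset.card_pos.1 (hT ▸ hq)
      have h3 := hic ρ
      rw [hi' ρ (hTS hρ), hκ ρ hρ] at h3
      refine le_antisymm ?_ h3
      by_contra hne
      obtain rfl : κ = 2 := le_antisymm (Fin.le_last _) (not_le.1 hne)
      have h4 : #T ≤ #(univ.filter fun ρ => c ρ = 2) :=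
        Finset.card_le_card fun ρ hρ => mem_filter.2 ⟨mem_univ _, hκ ρ hρ⟩
      have := hcount 2
      omega
    obtain rfl := hone s μ hs hscard hμ
    obtain rfl := hone (S \ s) μ' sdiff_subset
      (by rw [Finset.card_sdiff_of_subset hs]; omega) hμ'
    have h4 : #S ≤ #(univ.filter fun ρ => c ρ = 1) := by
      refine Finset.card_le_card fun ρ hρ => mem_filter.2 ⟨mem_univ _, ?_⟩
      by_cases h : ρ ∈ s
      · exact hμ ρ h
      · exact hμ' ρ (mem_sdiff.2 ⟨hρ, h⟩)
    have := hcount 1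
    omega

end TwoAndThree

theorem eq_topWeight_of_one_eq_zero {r : ℕ} {a : Composition 2 r} (h : a 1 = 0) :
    a = topWeight 2 r := by
  have h2 := a.2
  rw [Fin.sum_univ_two] at h2
  refine Subtype.ext (funext fun ν => ?_)
  fin_cases ν
  · change a 0 = r
    omega
  · exact h

/-- Makes the socle finitely generated, so that an isotypic socle is a finite power of one simple
module. -/
instance isNoetherian_borelSchur (K : Type u) [Field K] (n r : ℕ) :
    IsNoetherian (borelSchur K n r) (borelSchur K n r) := by
  have : Module.Finite K (TensorPow K n r) := Module.Finite.of_basis (tensorBasis K n r)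
  have h : IsNoetherian K (Subalgebra.toSubmodule (borelSchur K n r)) := inferInstance
  exact isNoetherian_of_tower K (by exact h)

end BorelSchur

theorem mainTheorem4 (K : Type u) [Field K] [Infinite K] (r : ℕ) (hr : 0 < r) :
    -- (1)
    (∀ (n : ℕ) [NeZero n],
      IsDirectSummand (borelSchur K n r) (WeightModule K (topWeight n r))
        (borelSchurSocle K n r)) ∧
    -- (2)
    (CharZero K →
      ∃ m : ℕ, 0 < m ∧
        Nonempty (borelSchurSocle K 2 r ≃ₗ[borelSchur K 2 r]
          (Fin m → WeightModule K (topWeight 2 r)))) ∧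
    -- (3)
    (∀ p : ℕ, p.Prime → CharP K p → ∀ a : Composition 2 r,
      (IsDirectSummand (borelSchur K 2 r) (WeightModule K a) (borelSchurSocle K 2 r) ↔
        a = topWeight 2 r ∨
          (a.IsPartition ∧ 0 < a 1 ∧ p ^ (Nat.log p (a 1) + 1) - 1 ≤ a 0))) ∧
    -- (4)
    (CharZero K → ∀ (n : ℕ) (hn : 3 ≤ n) (L : Type u) [AddCommGroup L]
        [Module (borelSchur K n r) L],
      IsCompositionFactor (borelSchur K n r) L (borelSchurSocle K n r) →
      ∃ a : Composition n r, a.IsPartition ∧ a ⟨n - 1, by omega⟩ = 0 ∧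
        Nonempty (L ≃ₗ[borelSchur K n r] WeightModule K a)) ∧
    -- (5)
    (∀ p : ℕ, p.Prime → CharP K p → ∀ (n : ℕ) (hn : 3 ≤ n) (L : Type u) [AddCommGroup L]
        [Module (borelSchur K n r) L],
      IsCompositionFactor (borelSchur K n r) L (borelSchurSocle K n r) →
      ∃ a : Composition n r, a.IsPartition ∧
        (a ⟨n - 1, by omega⟩ = 0 ∨
          p ^ (Nat.log p (a ⟨n - 1, by omega⟩) + 1) - 1 ≤ a ⟨n - 2, by omega⟩) ∧
        Nonempty (L ≃ₗ[borelSchur K n r] WeightModule K a)) ∧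
    -- (6)
    (∀ p : ℕ, p.Prime → 3 ≤ p → CharP K p → ∀ a : Composition 3 r, 0 < a 2 →
      p ^ (Nat.log p (a 2) + 2) - 1 ≤ a 0 →
      a 1 = 2 * p ^ (Nat.log p (a 2) + 1) - 1 →
      IsCompositionFactor (borelSchur K 3 r) (WeightModule K a) (borelSchurSocle K 3 r)) := by
  refine ⟨fun n _ => isDirectSummand_socle_iff.2 exists_isWeightVector_topWeight, fun _ => ?_,
    fun p hp _ a => ?_, fun _ n hn L _ _ hL => ?_, fun p hp _ n hn L _ _ hL => ?_,
    fun p hp hp3 _ a _ h0 h1 => ?_⟩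
  · have hiso : IsIsotypicOfType (borelSchur K 2 r) (borelSchurSocle K 2 r)
        (WeightModule K (topWeight 2 r)) := by
      refine isIsotypicOfType_socle fun N _ => ?_
      obtain ⟨a, ⟨x, hx0, hx⟩, he⟩ :=
        exists_linearEquiv_weightModule N.subtype N.subtype_injective
      rwa [eq_topWeight_of_one_eq_zero
        (hx.last_eq_zero hx0 (s := 0) (t := 1) (by decide) fun ν => by omega)] at he
    obtain ⟨m, ⟨e⟩⟩ := hiso.linearEquiv_fun
    refine ⟨m, Nat.pos_of_ne_zero ?_, ⟨e⟩⟩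
    -- An empty direct sum would make the socle zero, but it contains the module of the top weight.
    rintro rfl
    obtain ⟨P, -, -, ⟨e'⟩⟩ := isDirectSummand_socle_iff.2
      (exists_isWeightVector_topWeight (n := 2) (r := r) (K := K))
    have : Subsingleton (borelSchurSocle K 2 r) := e.toEquiv.subsingleton
    have : Subsingleton (WeightModule K (topWeight 2 r)) := e'.symm.toEquiv.subsingleton
    exact zero_ne_one (α := K) (this.elim (0 : K) (1 : K))
  · have : Fact p.Prime := ⟨hp⟩
    rw [isDirectSummand_socle_iff]
    constructor
    · rintro ⟨x, hx0, hx⟩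
      have h := hx.last_eq_zero_or p hx0 (s := 0) (t := 1) (by decide) fun ν => by omega
      rcases Nat.eq_zero_or_pos (a 1) with h1 | h1
      · exact Or.inl (eq_topWeight_of_one_eq_zero h1)
      · exact Or.inr ⟨hx.isPartition hx0, h1, h.resolve_left h1.ne'⟩
    · rintro (rfl | ⟨-, -, h⟩)
      · exact exists_isWeightVector_topWeight
      · exact exists_isWeightVector_two p h
  · have := hL.1
    obtain ⟨f, hf⟩ := hL.exists_injective
    obtain ⟨a, ⟨x, hx0, hx⟩, he⟩ := exists_linearEquiv_weightModule f hf
    refine ⟨a, hx.isPartition hx0, hx.last_eq_zero hx0 (s := ⟨n - 2, by omega⟩) ?_ fun ν => ?_, he⟩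
    · rw [Fin.lt_def]
      change n - 2 < n - 1
      omega
    · rw [Fin.le_def]
      change (ν : ℕ) ≤ n - 1
      omega
  · have : Fact p.Prime := ⟨hp⟩
    have := hL.1
    obtain ⟨f, hf⟩ := hL.exists_injective
    obtain ⟨a, ⟨x, hx0, hx⟩, he⟩ := exists_linearEquiv_weightModule f hf
    refine ⟨a, hx.isPartition hx0, hx.last_eq_zero_or p hx0 ?_ fun ν => ?_, he⟩
    · rw [Fin.lt_def]
      change n - 2 < n - 1
      omega
    · rw [Fin.le_def]
      change (ν : ℕ) ≤ n - 1
      omega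
  · have : Fact p.Prime := ⟨hp⟩
    have := isSimpleModule_weightModule (K := K) a
    obtain ⟨x, hx0, hx⟩ := exists_isWeightVector_three (K := K) p hp3 h0 h1
    exact isCompositionFactor_socle_of_injective hx.linearMap (hx.linearMap_injective hx0)
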